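/- Let $q\in\mathbb C$ with $q\ne 0$ and $q\neq\pm1$, and let $q^{1/2}$ be any square root of $q$. Let $H=\mathrm{SL}_q(2)$ be the unital $\mathbb C$-algebra generated by $\alpha,\beta,\gamma,\delta$ subject to $$\beta\alpha=q\alpha\beta,\quad \gamma\alpha=q\alpha\gamma,\quad \delta\beta=q\beta\delta,\quad \delta\gamma=q\gamma\delta,\quad \gamma\beta=\beta\gamma,\quad \alpha\delta-\delta\alpha=(q^{-1}-q)\beta\gamma,\quad \alpha\delta-q^{-1}\beta\gamma=1 .$$ It is a bialgebra with multiplication $m$, unit $u$, and comultiplication and counit the algebra maps given by $\Delta(t_{ij})=\sum_k t_{ik}\otimes t_{kj}$, $\varepsilon(t_{ij})=1$ if $i=j$ and $0$ otherwise, where $(t_{ij})=\begin{pmatrix}\alpha&\beta\\ \gamma&\delta\end{pmatrix}$. It is coquasitriangular with the universal $\mathcal R$-form $\mathcal R:H\otimes H\to\mathbb C$, that is, the convolution invertible linear map satisfying, for all $a,b,c\in H$ in Sweedler notation, $\mathcal R(a_1\otimes b_1)a_2b_2=b_1a_1\mathcal R(a_2\otimes b_2)$, $\mathcal R(a\otimes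 bc)=\mathcal R(a_1\otimes c)\mathcal R(a_2\otimes b)$ and $\mathcal R(ab\otimes c)=\mathcal R(a\otimes c_1)\mathcal R(b\otimes c_2)$, determined on generators by $$\mathcal R(\alpha\otimes\alpha)=\mathcal R(\delta\otimes\delta)=q^{-1/2}q,\quad \mathcal R(\alpha\otimes\delta)=\mathcal R(\delta\otimes\alpha)=q^{-1/2},\quad \mathcal R(\beta\otimes\gamma)=q^{-1/2}(q-q^{-1}),$$ and $\mathcal R=0$ on all other pairs of generators. An infinitesimal $\mathcal R$-form on $(H,\mathcal R)$ is a linear map $\chi:H\otimes H\to\mathbb C$ such that $$(u\chi)*m=m*(u\chi),\qquad \chi(\mathrm{Id}\otimes m)=\chi_{12}+\mathcal R^{-1}_{12}*\chi_{13}*\mathcal R_{12},\qquad \chi(m\otimes\mathrm{Id})=\chi_{23}+\mathcal R^{-1}_{23}*\chi_{13}*\mathcal R_{23},$$ where $*$ is the convolution product, $\mathcal R^{-1}$ is the convolution inverse of $\mathcal R$, and $f_{12}(a\otimes b\otimes c)=f(a\otimes b)\varepsilon(c)$, $f_{23}(a\otimes b\otimes c)=\varepsilon(a)f(b\otimes c)$,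 $f_{13}(a\otimes b\otimes c)=\varepsilon(b)f(a\otimes c)$. Then a linear map $\chi:H\otimes H\to\mathbb C$ is an infinitesimal $\mathcal R$-form on $(\mathrm{SL}_q(2),\mathcal R)$ if and only if $\chi=0$. -/

import Mathlib

open scoped TensorProduct

noncomputable section

section General

open Coalgebra WithConv

variable {𝕜 H : Type*} [Field 𝕜] [Ring H] [Bialgebra 𝕜 H]

/-- The leg notation `f₁₂ = f ⊗ ε`. -/
def leg12 (f : H ⊗[𝕜] H →ₗ[𝕜] 𝕜) : H ⊗[𝕜] (H ⊗[𝕜] H) →ₗ[𝕜] 𝕜 :=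
  LinearMap.mul' 𝕜 𝕜 ∘ₗ TensorProduct.map f counit ∘ₗ (TensorProduct.assoc 𝕜 H H H).symm.toLinearMap

/-- The leg notation `f₂₃ = ε ⊗ f`. -/
def leg23 (f : H ⊗[𝕜] H →ₗ[𝕜] 𝕜) : H ⊗[𝕜] (H ⊗[𝕜] H) →ₗ[𝕜] 𝕜 :=
  LinearMap.mul' 𝕜 𝕜 ∘ₗ TensorProduct.map counit f

/-- The leg notation `f₁₃ = (ε ⊗ f)(τ ⊗ id)`. -/
def leg13 (f : H ⊗[𝕜] H →ₗ[𝕜] 𝕜) : H ⊗[𝕜] (H ⊗[𝕜] H) →ₗ[𝕜] 𝕜 :=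
  leg23 f ∘ₗ (TensorProduct.leftComm 𝕜 H H H).toLinearMap

variable (𝕜 H) in
/-- `id ⊗ m : H ⊗ H ⊗ H → H ⊗ H`. -/
def idTensorMul : H ⊗[𝕜] (H ⊗[𝕜] H) →ₗ[𝕜] H ⊗[𝕜] H :=
  (LinearMap.mul' 𝕜 H).lTensor H

variable (𝕜 H) in
/-- `m ⊗ id : H ⊗ H ⊗ H → H ⊗ H`. -/
def mulTensorId : H ⊗[𝕜] (H ⊗[𝕜] H) →ₗ[𝕜] H ⊗[𝕜] H :=
  (LinearMap.mul' 𝕜 H).rTensor H ∘ₗ (TensorProduct.assoc 𝕜 H H H).symm.toLinearMap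

variable (𝕜 H) in
/-- A universal `R`-form on the bialgebra `H`: a convolution invertible linear map
`R : H ⊗ H → 𝕜` with `R * m = mᵒᵖ * R`, `R (id ⊗ m) = R₁₃ * R₁₂` and `R (m ⊗ id) = R₁₃ * R₂₃`,
all products being convolution products. -/
structure UniversalRForm where
  /-- `R`, as an invertible element of the convolution algebra. -/
  unit : (WithConv (H ⊗[𝕜] H →ₗ[𝕜] 𝕜))ˣ
  conv_mul :
    toConv (Algebra.linearMap 𝕜 H ∘ₗ unit.val.ofConv) * toConv (LinearMap.mul' 𝕜 H) =
      toConv (LinearMap.mul' 𝕜 H ∘ₗ (TensorProduct.comm 𝕜 H H).toLinearMap) *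
        toConv (Algebra.linearMap 𝕜 H ∘ₗ unit.val.ofConv)
  comp_idTensorMul :
    toConv (unit.val.ofConv ∘ₗ idTensorMul 𝕜 H) =
      toConv (leg13 unit.val.ofConv) * toConv (leg12 unit.val.ofConv)
  comp_mulTensorId :
    toConv (unit.val.ofConv ∘ₗ mulTensorId 𝕜 H) =
      toConv (leg13 unit.val.ofConv) * toConv (leg23 unit.val.ofConv)

/-- The linear map `R : H ⊗ H → 𝕜`. -/
def UniversalRForm.form (R : UniversalRForm 𝕜 H) : H ⊗[𝕜] H →ₗ[𝕜] 𝕜 := R.unit.val.ofConv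

/-- The convolution inverse `R⁻¹ : H ⊗ H → 𝕜`. -/
def UniversalRForm.invForm (R : UniversalRForm 𝕜 H) : H ⊗[𝕜] H →ₗ[𝕜] 𝕜 := R.unit.inv.ofConv

/-- `χ` is an infinitesimal `R`-form on the coquasitriangular bialgebra `(H, R)`:
`(uχ) * m = m * (uχ)`, `χ (id ⊗ m) = χ₁₂ + R⁻¹₁₂ * χ₁₃ * R₁₂` and
`χ (m ⊗ id) = χ₂₃ + R⁻¹₂₃ * χ₁₃ * R₂₃`, all products being convolution products. -/
structure IsInfinitesimalRForm (R : UniversalRForm 𝕜 H) (χ : H ⊗[𝕜] H →ₗ[𝕜] 𝕜) : Prop where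
  conv_mul :
    toConv (Algebra.linearMap 𝕜 H ∘ₗ χ) * toConv (LinearMap.mul' 𝕜 H) =
      toConv (LinearMap.mul' 𝕜 H) * toConv (Algebra.linearMap 𝕜 H ∘ₗ χ)
  comp_idTensorMul :
    toConv (χ ∘ₗ idTensorMul 𝕜 H) =
      toConv (leg12 χ) + toConv (leg12 R.invForm) * toConv (leg13 χ) * toConv (leg12 R.form)
  comp_mulTensorId :
    toConv (χ ∘ₗ mulTensorId 𝕜 H) =
      toConv (leg23 χ) + toConv (leg23 R.invForm) * toConv (leg13 χ) * toConv (leg23 R.form)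

/-- The linear map `a ⊗ b ↦ φ a b`. -/
def uncurryConv (φ : H →ₗ[𝕜] WithConv (H →ₗ[𝕜] 𝕜)) : H ⊗[𝕜] H →ₗ[𝕜] 𝕜 :=
  TensorProduct.lift ((WithConv.linearEquiv 𝕜 (H →ₗ[𝕜] 𝕜)).toLinearMap ∘ₗ φ)

@[simp] theorem uncurryConv_tmul (φ : H →ₗ[𝕜] WithConv (H →ₗ[𝕜] 𝕜)) (a b : H) :
    uncurryConv φ (a ⊗ₜ b) = φ a b := rfl

theorem convMul_tmul {A : Type*} [Ring A] [Algebra 𝕜 A]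
    (f g : WithConv (H ⊗[𝕜] H →ₗ[𝕜] A)) (a b : H) {ι κ : Type*} (ra : Repr 𝕜 a ι)
    (rb : Repr 𝕜 b κ) : (f * g) (a ⊗ₜ b) = ∑ i ∈ ra.index, ∑ j ∈ rb.index,
      f (ra.left i ⊗ₜ rb.left j) * g (ra.right i ⊗ₜ rb.right j) := by
  rw [LinearMap.convMul_apply, TensorProduct.comul_tmul, ← ra.eq, ← rb.eq]
  simp only [TensorProduct.sum_tmul, TensorProduct.tmul_sum, map_sum,
    TensorProduct.AlgebraTensorModule.tensorTensorTensorComm_tmul, TensorProduct.map_tmul,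
    LinearMap.mul'_apply]
  exact Finset.sum_comm

theorem convMul_uncurryConv (φ ψ : H →ₗ[𝕜] WithConv (H →ₗ[𝕜] 𝕜)) (a b : H) :
    (toConv (uncurryConv φ) * toConv (uncurryConv ψ)) (a ⊗ₜ b) =
      (LinearMap.mul' 𝕜 (WithConv (H →ₗ[𝕜] 𝕜)) (TensorProduct.map φ ψ (comul a))) b := by
  rw [convMul_tmul _ _ a b (ℛ 𝕜 a) (ℛ 𝕜 b), ← (ℛ 𝕜 a).eq]
  simp [(ℛ 𝕜 b).convMul_apply]

@[simp] theorem leg12_tmul (f : H ⊗[𝕜] H →ₗ[𝕜] 𝕜) (a b c : H) :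
    leg12 f (a ⊗ₜ (b ⊗ₜ c)) = f (a ⊗ₜ b) * counit c := rfl

@[simp] theorem leg23_tmul (f : H ⊗[𝕜] H →ₗ[𝕜] 𝕜) (a b c : H) :
    leg23 f (a ⊗ₜ (b ⊗ₜ c)) = counit a * f (b ⊗ₜ c) := rfl

@[simp] theorem leg13_tmul (f : H ⊗[𝕜] H →ₗ[𝕜] 𝕜) (a b c : H) :
    leg13 f (a ⊗ₜ (b ⊗ₜ c)) = counit b * f (a ⊗ₜ c) := rfl

theorem convMul_tmul_tmul (f g : WithConv (H ⊗[𝕜] (H ⊗[𝕜] H) →ₗ[𝕜] 𝕜)) (a b c : H) :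
    (f * g) (a ⊗ₜ (b ⊗ₜ c)) =
      ∑ i ∈ (ℛ 𝕜 a).index, ∑ j ∈ (ℛ 𝕜 b).index, ∑ k ∈ (ℛ 𝕜 c).index,
        f ((ℛ 𝕜 a).left i ⊗ₜ ((ℛ 𝕜 b).left j ⊗ₜ (ℛ 𝕜 c).left k)) *
          g ((ℛ 𝕜 a).right i ⊗ₜ ((ℛ 𝕜 b).right j ⊗ₜ (ℛ 𝕜 c).right k)) := by
  rw [LinearMap.convMul_apply, TensorProduct.comul_tmul, TensorProduct.comul_tmul]
  conv_lhs => rw [← (ℛ 𝕜 a).eq, ← (ℛ 𝕜 b).eq, ← (ℛ 𝕜 c).eq]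
  simp only [TensorProduct.sum_tmul, TensorProduct.tmul_sum, map_sum,
    TensorProduct.AlgebraTensorModule.tensorTensorTensorComm_tmul, TensorProduct.map_tmul,
    LinearMap.mul'_apply]
  rw [Finset.sum_comm]
  conv_lhs => enter [2, x]; rw [Finset.sum_comm]
  rw [Finset.sum_comm]

theorem sum_counit_left (f : H →ₗ[𝕜] 𝕜) (a : H) :
    ∑ i ∈ (ℛ 𝕜 a).index, counit ((ℛ 𝕜 a).left i) * f ((ℛ 𝕜 a).right i) = f a := by
  conv_rhs => rw [← sum_counit_smul (ℛ 𝕜 a)]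
  simp

theorem sum_counit_right (f : H →ₗ[𝕜] 𝕜) (a : H) :
    ∑ i ∈ (ℛ 𝕜 a).index, f ((ℛ 𝕜 a).left i) * counit ((ℛ 𝕜 a).right i) = f a := by
  have h := congrArg (TensorProduct.lift ((LinearMap.mul 𝕜 𝕜) ∘ₗ f))
    (sum_tmul_counit_eq (R := 𝕜) (ℛ 𝕜 a))
  simpa only [map_sum, TensorProduct.lift.tmul, LinearMap.comp_apply, LinearMap.mul_apply',
    mul_one] using h

theorem leg13_convMul_leg23 (f g : H ⊗[𝕜] H →ₗ[𝕜] 𝕜) (a b c : H) :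
    (toConv (leg13 f) * toConv (leg23 g)) (a ⊗ₜ (b ⊗ₜ c)) =
      ∑ k ∈ (ℛ 𝕜 c).index, f (a ⊗ₜ (ℛ 𝕜 c).left k) * g (b ⊗ₜ (ℛ 𝕜 c).right k) := by
  rw [convMul_tmul_tmul]
  refine ((Finset.sum_congr rfl fun i _ => Finset.sum_comm).trans Finset.sum_comm).trans ?_
  refine Finset.sum_congr rfl fun k _ => ?_
  have ha := sum_counit_right (f ∘ₗ (TensorProduct.mk 𝕜 H H).flip ((ℛ 𝕜 c).left k)) a
  have hb := sum_counit_left (g ∘ₗ (TensorProduct.mk 𝕜 H H).flip ((ℛ 𝕜 c).right k)) b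
  simp only [LinearMap.comp_apply, LinearMap.flip_apply, TensorProduct.mk_apply] at ha hb
  rw [← ha, ← hb, Finset.sum_mul_sum]
  refine Finset.sum_congr rfl fun i _ => Finset.sum_congr rfl fun j _ => ?_
  simp only [leg13_tmul, leg23_tmul]
  ring

theorem leg13_convMul_leg12 (f g : H ⊗[𝕜] H →ₗ[𝕜] 𝕜) (a b c : H) :
    (toConv (leg13 f) * toConv (leg12 g)) (a ⊗ₜ (b ⊗ₜ c)) =
      ∑ i ∈ (ℛ 𝕜 a).index, f ((ℛ 𝕜 a).left i ⊗ₜ c) * g ((ℛ 𝕜 a).right i ⊗ₜ b) := by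
  rw [convMul_tmul_tmul]
  refine Finset.sum_congr rfl fun i _ => ?_
  have hc := sum_counit_right (f ∘ₗ TensorProduct.mk 𝕜 H H ((ℛ 𝕜 a).left i)) c
  have hb := sum_counit_left (g ∘ₗ TensorProduct.mk 𝕜 H H ((ℛ 𝕜 a).right i)) b
  simp only [LinearMap.comp_apply, TensorProduct.mk_apply] at hb hc
  rw [← hb, ← hc, Finset.sum_mul_sum, Finset.sum_comm]
  refine Finset.sum_congr rfl fun k _ => Finset.sum_congr rfl fun j _ => ?_
  simp only [leg13_tmul, leg12_tmul]
  ring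

end General

/-- The defining relations of `SL_q(2)` on the free generators `α, β, γ, δ`, which are indexed by
`(0, 0), (0, 1), (1, 0), (1, 1)`: the Manin relations `βα = qαβ`, `γα = qαγ`, `δβ = qβδ`,
`δγ = qγδ`, `γβ = βγ`, `αδ - δα = (q⁻¹ - q)βγ` and the relation `αδ - q⁻¹βγ = 1`. -/
inductive SLq2.Rel {𝕜 : Type*} [Field 𝕜] (q : 𝕜ˣ) :
    FreeAlgebra 𝕜 (Fin 2 × Fin 2) → FreeAlgebra 𝕜 (Fin 2 × Fin 2) → Prop
  | ba : Rel q (FreeAlgebra.ι 𝕜 (0, 1) * FreeAlgebra.ι 𝕜 (0, 0))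
      ((q : 𝕜) • (FreeAlgebra.ι 𝕜 (0, 0) * FreeAlgebra.ι 𝕜 (0, 1)))
  | ca : Rel q (FreeAlgebra.ι 𝕜 (1, 0) * FreeAlgebra.ι 𝕜 (0, 0))
      ((q : 𝕜) • (FreeAlgebra.ι 𝕜 (0, 0) * FreeAlgebra.ι 𝕜 (1, 0)))
  | db : Rel q (FreeAlgebra.ι 𝕜 (1, 1) * FreeAlgebra.ι 𝕜 (0, 1))
      ((q : 𝕜) • (FreeAlgebra.ι 𝕜 (0, 1) * FreeAlgebra.ι 𝕜 (1, 1)))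
  | dc : Rel q (FreeAlgebra.ι 𝕜 (1, 1) * FreeAlgebra.ι 𝕜 (1, 0))
      ((q : 𝕜) • (FreeAlgebra.ι 𝕜 (1, 0) * FreeAlgebra.ι 𝕜 (1, 1)))
  | cb : Rel q (FreeAlgebra.ι 𝕜 (1, 0) * FreeAlgebra.ι 𝕜 (0, 1))
      (FreeAlgebra.ι 𝕜 (0, 1) * FreeAlgebra.ι 𝕜 (1, 0))
  | ad : Rel q
      (FreeAlgebra.ι 𝕜 (0, 0) * FreeAlgebra.ι 𝕜 (1, 1)
        - FreeAlgebra.ι 𝕜 (1, 1) * FreeAlgebra.ι 𝕜 (0, 0))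
      (((q : 𝕜)⁻¹ - (q : 𝕜)) • (FreeAlgebra.ι 𝕜 (0, 1) * FreeAlgebra.ι 𝕜 (1, 0)))
  | det : Rel q
      (FreeAlgebra.ι 𝕜 (0, 0) * FreeAlgebra.ι 𝕜 (1, 1)
        - (q : 𝕜)⁻¹ • (FreeAlgebra.ι 𝕜 (0, 1) * FreeAlgebra.ι 𝕜 (1, 0))) 1

/-- The algebra `SL_q(2)`. -/
def SLq2 {𝕜 : Type*} [Field 𝕜] (q : 𝕜ˣ) : Type _ := RingQuot (SLq2.Rel q)

namespace SLq2

variable {𝕜 : Type*} [Field 𝕜]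

instance (q : 𝕜ˣ) : Ring (SLq2 q) := inferInstanceAs (Ring (RingQuot (SLq2.Rel q)))

instance (q : 𝕜ˣ) : Algebra 𝕜 (SLq2 q) := inferInstanceAs (Algebra 𝕜 (RingQuot (SLq2.Rel q)))

/-- The quotient map from the free algebra. -/
def mk (q : 𝕜ˣ) : FreeAlgebra 𝕜 (Fin 2 × Fin 2) →ₐ[𝕜] SLq2 q := RingQuot.mkAlgHom 𝕜 (SLq2.Rel q)

/-- The generators, `T 0 0 = α`, `T 0 1 = β`, `T 1 0 = γ`, `T 1 1 = δ`. -/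
def T (q : 𝕜ˣ) (i j : Fin 2) : SLq2 q := mk q (FreeAlgebra.ι 𝕜 (i, j))

/-- Four elements `M 0 0, M 0 1, M 1 0, M 1 1` of an algebra satisfying the relations of `SL_q(2)`. -/
structure Relations (q : 𝕜ˣ) {A : Type*} [Ring A] [Algebra 𝕜 A] (M : Fin 2 → Fin 2 → A) :
    Prop where
  ba : M 0 1 * M 0 0 = (q : 𝕜) • (M 0 0 * M 0 1)
  ca : M 1 0 * M 0 0 = (q : 𝕜) • (M 0 0 * M 1 0)
  db : M 1 1 * M 0 1 = (q : 𝕜) • (M 0 1 * M 1 1)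
  dc : M 1 1 * M 1 0 = (q : 𝕜) • (M 1 0 * M 1 1)
  cb : M 1 0 * M 0 1 = M 0 1 * M 1 0
  ad : M 0 0 * M 1 1 - M 1 1 * M 0 0 = ((q : 𝕜)⁻¹ - (q : 𝕜)) • (M 0 1 * M 1 0)
  det : M 0 0 * M 1 1 - (q : 𝕜)⁻¹ • (M 0 1 * M 1 0) = 1

theorem mk_rel {q : 𝕜ˣ} {x y : FreeAlgebra 𝕜 (Fin 2 × Fin 2)} (h : Rel q x y) :
    mk q x = mk q y :=
  RingQuot.mkAlgHom_rel 𝕜 h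

theorem relations_T (q : 𝕜ˣ) : Relations q (T q) where
  ba := by simpa only [T, map_mul, map_smul] using mk_rel (Rel.ba (q := q))
  ca := by simpa only [T, map_mul, map_smul] using mk_rel (Rel.ca (q := q))
  db := by simpa only [T, map_mul, map_smul] using mk_rel (Rel.db (q := q))
  dc := by simpa only [T, map_mul, map_smul] using mk_rel (Rel.dc (q := q))
  cb := by simpa only [T, map_mul] using mk_rel (Rel.cb (q := q))
  ad := by simpa only [T, map_mul, map_sub, map_smul] using mk_rel (Rel.ad (q := q))
  det := by simpa only [T, map_mul, map_sub, map_smul, map_one] using mk_rel (Rel.det (q := q))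

/-- The universal property of `SL_q(2)`. -/
def lift {q : 𝕜ˣ} {A : Type*} [Ring A] [Algebra 𝕜 A] (M : Fin 2 → Fin 2 → A)
    (h : Relations q M) : SLq2 q →ₐ[𝕜] A :=
  RingQuot.liftAlgHom 𝕜 ⟨FreeAlgebra.lift 𝕜 fun p => M p.1 p.2, by
    rintro _ _ (_ | _ | _ | _ | _ | _ | _)
    · simpa using h.ba
    · simpa using h.ca
    · simpa using h.db
    · simpa using h.dc
    · simpa using h.cb
    · simpa only [map_mul, map_sub, map_smul, FreeAlgebra.lift_ι_apply] using h.ad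
    · simpa only [map_mul, map_sub, map_smul, map_one, FreeAlgebra.lift_ι_apply] using h.det⟩

@[simp] theorem lift_T {q : 𝕜ˣ} {A : Type*} [Ring A] [Algebra 𝕜 A] (M : Fin 2 → Fin 2 → A)
    (h : Relations q M) (i j : Fin 2) : lift M h (T q i j) = M i j := by
  exact (RingQuot.liftAlgHom_mkAlgHom_apply 𝕜 _ _ _).trans (FreeAlgebra.lift_ι_apply _ _)

theorem hom_ext {q : 𝕜ˣ} {A : Type*} [Ring A] [Algebra 𝕜 A] {f g : SLq2 q →ₐ[𝕜] A}
    (h : ∀ i j, f (T q i j) = g (T q i j)) : f = g := by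
  apply RingQuot.ringQuot_ext'
  apply FreeAlgebra.hom_ext
  funext p
  exact h p.1 p.2

theorem induction {q : 𝕜ˣ} {P : SLq2 q → Prop} (hs : ∀ r : 𝕜, P (algebraMap 𝕜 _ r))
    (hT : ∀ i j, P (T q i j)) (hm : ∀ x y, P x → P y → P (x * y))
    (ha : ∀ x y, P x → P y → P (x + y)) (x : SLq2 q) : P x := by
  obtain ⟨x, rfl⟩ := RingQuot.mkAlgHom_surjective 𝕜 (Rel q) x
  induction x using FreeAlgebra.induction with
  | grade0 r => rw [AlgHom.commutes]; exact hs r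
  | grade1 p => exact hT p.1 p.2
  | mul a b iha ihb => rw [map_mul]; exact hm _ _ iha ihb
  | add a b iha ihb => rw [map_add]; exact ha _ _ iha ihb

theorem T_ba (q : 𝕜ˣ) : T q 0 1 * T q 0 0 = (q : 𝕜) • (T q 0 0 * T q 0 1) := (relations_T q).ba
theorem T_ca (q : 𝕜ˣ) : T q 1 0 * T q 0 0 = (q : 𝕜) • (T q 0 0 * T q 1 0) := (relations_T q).ca
theorem T_db (q : 𝕜ˣ) : T q 1 1 * T q 0 1 = (q : 𝕜) • (T q 0 1 * T q 1 1) := (relations_T q).db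
theorem T_dc (q : 𝕜ˣ) : T q 1 1 * T q 1 0 = (q : 𝕜) • (T q 1 0 * T q 1 1) := (relations_T q).dc
theorem T_cb (q : 𝕜ˣ) : T q 1 0 * T q 0 1 = T q 0 1 * T q 1 0 := (relations_T q).cb
theorem T_ad (q : 𝕜ˣ) : T q 0 0 * T q 1 1 = 1 + (q : 𝕜)⁻¹ • (T q 0 1 * T q 1 0) := by
  rw [← (relations_T q).det]; abel
theorem T_da (q : 𝕜ˣ) : T q 1 1 * T q 0 0 = 1 + (q : 𝕜) • (T q 0 1 * T q 1 0) := by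
  have h1 := (relations_T q).ad
  rw [T_ad, sub_smul] at h1
  rw [sub_eq_iff_eq_add] at h1
  have h2 : T q 1 1 * T q 0 0 = 1 + (q : 𝕜)⁻¹ • (T q 0 1 * T q 1 0)
      - ((q : 𝕜)⁻¹ • (T q 0 1 * T q 1 0) - (q : 𝕜) • (T q 0 1 * T q 1 0)) := by
    rw [h1]; abel
  rw [h2]; abel

theorem relations_comul (q : 𝕜ˣ) :
    Relations q fun i j => ∑ k, T q i k ⊗ₜ[𝕜] T q k j := by
  have hq : (q : 𝕜) ≠ 0 := q.ne_zero
  constructor <;>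
  simp only [Fin.sum_univ_two, add_mul, mul_add, Algebra.TensorProduct.tmul_mul_tmul, T_ba, T_ca,
    T_db, T_dc, T_cb, T_ad, T_da, TensorProduct.tmul_smul, ← TensorProduct.smul_tmul', TensorProduct.add_tmul, TensorProduct.tmul_add, smul_add, smul_smul, Algebra.TensorProduct.one_def] <;>
  match_scalars <;> field_simp <;> ring

/-- The comultiplication. -/
def comulHom (q : 𝕜ˣ) : SLq2 q →ₐ[𝕜] SLq2 q ⊗[𝕜] SLq2 q := lift _ (relations_comul q)

theorem relations_counit (q : 𝕜ˣ) :
    Relations q fun i j => if i = j then (1 : 𝕜) else 0 := by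
  constructor <;> simp

/-- The counit. -/
def counitHom (q : 𝕜ˣ) : SLq2 q →ₐ[𝕜] 𝕜 := lift _ (relations_counit q)

instance (q : 𝕜ˣ) : Bialgebra 𝕜 (SLq2 q) :=
  Bialgebra.ofAlgHom (comulHom q) (counitHom q)
    (hom_ext fun i j => by
      simp [comulHom, TensorProduct.tmul_add, TensorProduct.add_tmul]; abel)
    (hom_ext fun i j => by
      fin_cases i <;> fin_cases j <;> simp [comulHom, counitHom])
    (hom_ext fun i j => by
      fin_cases i <;> fin_cases j <;> simp [comulHom, counitHom])

theorem comul_T (q : 𝕜ˣ) (i j : Fin 2) :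
    Coalgebra.comul (R := 𝕜) (T q i j) = ∑ k, T q i k ⊗ₜ[𝕜] T q k j :=
  lift_T _ (relations_comul q) i j

theorem counit_T (q : 𝕜ˣ) (i j : Fin 2) :
    Coalgebra.counit (R := 𝕜) (T q i j) = if i = j then 1 else 0 :=
  lift_T _ (relations_counit q) i j


theorem relations_antipode (q : 𝕜ˣ) :
    Relations q (A := (SLq2 q)ᵐᵒᵖ) ![![.op (T q 1 1), .op (-(q : 𝕜) • T q 0 1)],
      ![.op (-(q : 𝕜)⁻¹ • T q 1 0), .op (T q 0 0)]] := by
  have hq : (q : 𝕜) ≠ 0 := q.ne_zero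
  constructor <;> apply MulOpposite.unop_injective <;>
  simp [T_ba, T_ca, T_db, T_dc, T_cb, T_ad, T_da, smul_smul] <;>
  match_scalars <;> field_simp

/-- The antipode, as an anti-homomorphism: `α ↦ δ`, `β ↦ -qβ`, `γ ↦ -q⁻¹γ`, `δ ↦ α`. -/
def antipodeHom (q : 𝕜ˣ) : SLq2 q →ₐ[𝕜] (SLq2 q)ᵐᵒᵖ := lift _ (relations_antipode q)

/-- The antipode as a linear map. -/
def S (q : 𝕜ˣ) : SLq2 q →ₗ[𝕜] SLq2 q :=
  (MulOpposite.opLinearEquiv 𝕜).symm.toLinearMap ∘ₗ (antipodeHom q).toLinearMap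

theorem S_mul (q : 𝕜ˣ) (x y : SLq2 q) : S q (x * y) = S q y * S q x := by
  simp [S]

theorem S_one (q : 𝕜ˣ) : S q 1 = 1 := by simp [S]

theorem S_T (q : 𝕜ˣ) (i j : Fin 2) : S q (T q i j) =
    ![![T q 1 1, -(q : 𝕜) • T q 0 1], ![-(q : 𝕜)⁻¹ • T q 1 0, T q 0 0]] i j := by
  fin_cases i <;> fin_cases j <;> simp [S, antipodeHom]

open Coalgebra WithConv

theorem mul_S (q : 𝕜ˣ) (x : SLq2 q) :
    LinearMap.mul' 𝕜 _ ((S q).lTensor _ (comul x)) = algebraMap 𝕜 _ (counit x) := by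
  have hq : (q : 𝕜) ≠ 0 := q.ne_zero
  induction x using SLq2.induction with
  | hs r => simp [S_one, Algebra.TensorProduct.algebraMap_apply]
  | hT i j =>
    rw [comul_T, counit_T]
    fin_cases i <;> fin_cases j <;>
    simp [S_T, T_ba, T_ca, T_db, T_dc, T_cb, T_ad, T_da, smul_smul, hq]
  | hm x y hx hy =>
    rw [← (ℛ 𝕜 x).eq] at hx
    rw [← (ℛ 𝕜 y).eq] at hy
    simp only [map_sum, LinearMap.lTensor_tmul, LinearMap.mul'_apply] at hx hy
    rw [Bialgebra.comul_mul, ← (ℛ 𝕜 x).eq, ← (ℛ 𝕜 y).eq, Bialgebra.counit_mul, map_mul (algebraMap 𝕜 (SLq2 q)), ← hx]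
    simp only [Finset.sum_mul_sum, Algebra.TensorProduct.tmul_mul_tmul]
    simp only [Finset.sum_mul, map_sum, LinearMap.lTensor_tmul, LinearMap.mul'_apply, S_mul]
    refine Finset.sum_congr rfl fun i _ => ?_
    rw [mul_assoc, ← Algebra.commutes, ← hy]
    simp only [Finset.sum_mul, Finset.mul_sum, mul_assoc]
  | ha x y hx hy => simp only [map_add, hx, hy]

theorem S_mul' (q : 𝕜ˣ) (x : SLq2 q) :
    LinearMap.mul' 𝕜 _ ((S q).rTensor _ (comul x)) = algebraMap 𝕜 _ (counit x) := by
  have hq : (q : 𝕜) ≠ 0 := q.ne_zero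
  induction x using SLq2.induction with
  | hs r => simp [Algebra.algebraMap_eq_smul_one, S_one, Algebra.TensorProduct.one_def]
  | hT i j =>
    rw [comul_T, counit_T]
    fin_cases i <;> fin_cases j <;>
    simp [S_T, T_ba, T_ca, T_db, T_dc, T_cb, T_ad, T_da, smul_smul, hq]
  | hm x y hx hy =>
    rw [← (ℛ 𝕜 x).eq] at hx
    rw [← (ℛ 𝕜 y).eq] at hy
    simp only [map_sum, LinearMap.rTensor_tmul, LinearMap.mul'_apply] at hx hy
    rw [Bialgebra.comul_mul, ← (ℛ 𝕜 x).eq, ← (ℛ 𝕜 y).eq, Bialgebra.counit_mul,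
      map_mul (algebraMap 𝕜 (SLq2 q)), Algebra.commutes, ← hy]
    simp only [Finset.sum_mul_sum, Algebra.TensorProduct.tmul_mul_tmul]
    simp only [Finset.sum_mul, map_sum, LinearMap.rTensor_tmul, LinearMap.mul'_apply, S_mul]
    rw [Finset.sum_comm]
    refine Finset.sum_congr rfl fun i _ => ?_
    rw [mul_assoc, ← Algebra.commutes, ← hx]
    simp only [Finset.sum_mul, Finset.mul_sum, mul_assoc]
  | ha x y hx hy => simp only [map_add, hx, hy]

/-- The values `R (T i j ⊗ T k l)` on generators, where `s` is a square root of `q`: they are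
`s⁻¹ q` on `α ⊗ α` and `δ ⊗ δ`, `s⁻¹` on `α ⊗ δ` and `δ ⊗ α`, `s⁻¹ (q - q⁻¹)` on `β ⊗ γ`, and
zero on the other pairs. -/
def rVal (q s : 𝕜ˣ) (i j k l : Fin 2) : 𝕜 :=
  (s : 𝕜)⁻¹ * if i = j ∧ k = l then (if i = k then (q : 𝕜) else 1)
    else if i = 0 ∧ j = 1 ∧ k = 1 ∧ l = 0 then (q : 𝕜) - (q : 𝕜)⁻¹ else 0

theorem relations_L {q s : 𝕜ˣ} (hs : s ^ 2 = q) :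
    Relations q (A := (Matrix (Fin 2) (Fin 2) 𝕜)ᵐᵒᵖ)
      fun k l => .op (Matrix.of fun i j => rVal q s i j k l) := by
  have hs0 : (s : 𝕜) ≠ 0 := s.ne_zero
  subst hs
  constructor <;> apply MulOpposite.unop_injective <;> ext i j <;>
  fin_cases i <;> fin_cases j <;>
  simp [rVal, Matrix.mul_apply] <;> field_simp <;> ring

/-- The anti-homomorphism `b ↦ (R (T i j ⊗ b))ᵢⱼ` to `2 × 2` matrices. -/
def L {q s : 𝕜ˣ} (hs : s ^ 2 = q) : SLq2 q →ₐ[𝕜] (Matrix (Fin 2) (Fin 2) 𝕜)ᵐᵒᵖ :=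
  lift _ (relations_L hs)

/-- The linear form `b ↦ R (T i j ⊗ b)`. -/
def ell {q s : 𝕜ˣ} (hs : s ^ 2 = q) (i j : Fin 2) : SLq2 q →ₗ[𝕜] 𝕜 where
  toFun b := (L hs b).unop i j
  map_add' := by simp
  map_smul' := by simp

theorem ell_T {q s : 𝕜ˣ} (hs : s ^ 2 = q) (i j k l : Fin 2) :
    ell hs i j (T q k l) = rVal q s i j k l := by
  simp [ell, L]

theorem ell_mul {q s : 𝕜ˣ} (hs : s ^ 2 = q) (i j : Fin 2) (b c : SLq2 q) :
    ell hs i j (b * c) = ∑ k, ell hs i k c * ell hs k j b := by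
  simp [ell, Matrix.mul_apply]

theorem ell_algebraMap {q s : 𝕜ˣ} (hs : s ^ 2 = q) (i j : Fin 2) (r : 𝕜) :
    ell hs i j (algebraMap 𝕜 _ r) = if i = j then r else 0 := by
  simp [ell, Matrix.algebraMap_matrix_apply]

theorem ell_one {q s : 𝕜ˣ} (hs : s ^ 2 = q) (i j : Fin 2) :
    ell hs i j 1 = if i = j then 1 else 0 := by
  simp [ell, Matrix.one_apply]

theorem ellell_mul {q s : 𝕜ˣ} (hs : s ^ 2 = q) (i j k l : Fin 2) (b c : SLq2 q) :
    (toConv (ell hs i j) * toConv (ell hs k l)) (b * c) =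
      ∑ m, ∑ n, (toConv (ell hs i m) * toConv (ell hs k n)) c *
        (toConv (ell hs m j) * toConv (ell hs n l)) b := by
  simp only [LinearMap.convMul_apply, Bialgebra.comul_mul]
  rw [← (ℛ 𝕜 b).eq, ← (ℛ 𝕜 c).eq]
  simp only [Finset.sum_mul_sum, map_sum, Algebra.TensorProduct.tmul_mul_tmul,
    TensorProduct.map_tmul, LinearMap.mul'_apply, ell_mul, Fin.sum_univ_two,
    ← Finset.sum_add_distrib]
  rw [Finset.sum_comm]
  refine Finset.sum_congr rfl fun _ _ => Finset.sum_congr rfl fun _ _ => ?_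
  ring

theorem ellell_T {q s : 𝕜ˣ} (hs : s ^ 2 = q) (i j k l m n : Fin 2) :
    (toConv (ell hs i j) * toConv (ell hs k l)) (T q m n) =
      ∑ p, rVal q s i j m p * rVal q s k l p n := by
  simp [LinearMap.convMul_apply, comul_T, ell_T]

theorem ellell_algebraMap {q s : 𝕜ˣ} (hs : s ^ 2 = q) (i j k l : Fin 2) (r : 𝕜) :
    (toConv (ell hs i j) * toConv (ell hs k l)) (algebraMap 𝕜 _ r) =
      if i = j ∧ k = l then r else 0 := by
  rw [ite_and, LinearMap.convMul_apply, Bialgebra.comul_algebraMap]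
  simp [Algebra.TensorProduct.algebraMap_apply, ell_algebraMap, ell_one]
  split_ifs <;> rfl

/-- The invariant vector of `V ⊗ V`. -/
def qvec (q : 𝕜ˣ) (i k : Fin 2) : 𝕜 :=
  if i = 0 ∧ k = 1 then 1 else if i = 1 ∧ k = 0 then -(q : 𝕜)⁻¹ else 0

theorem ellell_right {q s : 𝕜ˣ} (hs : s ^ 2 = q) (b : SLq2 q) : ∀ i k : Fin 2,
    (toConv (ell hs i 0) * toConv (ell hs k 1)) b
      - (q : 𝕜)⁻¹ * (toConv (ell hs i 1) * toConv (ell hs k 0)) b = counit b * qvec q i k := by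
  induction b using SLq2.induction with
  | hs r =>
    intro i k
    rw [ellell_algebraMap, ellell_algebraMap]
    fin_cases i <;> fin_cases k <;> simp [qvec, mul_comm]
  | hT m n =>
    intro i k
    have hs0 : (s : 𝕜) ≠ 0 := s.ne_zero
    rw [ellell_T, ellell_T, counit_T]
    subst hs
    fin_cases i <;> fin_cases k <;> fin_cases m <;> fin_cases n <;>
    simp [rVal, qvec] <;> field_simp <;> ring
  | hm x y hx hy =>
    intro i k
    rw [ellell_mul, ellell_mul, Bialgebra.counit_mul]
    simp only [Fin.sum_univ_two]
    have h00 := hx 0 0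
    have h01 := hx 0 1
    have h10 := hx 1 0
    have h11 := hx 1 1
    have hy := hy i k
    simp only [qvec, one_ne_zero, zero_ne_one, and_false, and_true, and_self, if_true, if_false, 
      mul_zero, mul_one] at h00 h01 h10 h11
    linear_combination (toConv (ell hs i 0) * toConv (ell hs k 0)) y * h00 +
      (toConv (ell hs i 0) * toConv (ell hs k 1)) y * h01 +
      (toConv (ell hs i 1) * toConv (ell hs k 0)) y * h10 +
      (toConv (ell hs i 1) * toConv (ell hs k 1)) y * h11 + counit x * hy
  | ha x y hx hy =>
    intro i k
    simp only [map_add]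
    linear_combination hx i k + hy i k

theorem ellell_left {q s : 𝕜ˣ} (hs : s ^ 2 = q) (b : SLq2 q) : ∀ j l : Fin 2,
    (toConv (ell hs 0 j) * toConv (ell hs 1 l)) b
      - (q : 𝕜)⁻¹ * (toConv (ell hs 1 j) * toConv (ell hs 0 l)) b = counit b * qvec q j l := by
  induction b using SLq2.induction with
  | hs r =>
    intro i k
    rw [ellell_algebraMap, ellell_algebraMap]
    fin_cases i <;> fin_cases k <;> simp [qvec, mul_comm]
  | hT m n =>
    intro i k
    have hs0 : (s : 𝕜) ≠ 0 := s.ne_zero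
    rw [ellell_T, ellell_T, counit_T]
    subst hs
    fin_cases i <;> fin_cases k <;> fin_cases m <;> fin_cases n <;>
    simp [rVal, qvec] <;> field_simp <;> ring
  | hm x y hx hy =>
    intro i k
    rw [ellell_mul, ellell_mul, Bialgebra.counit_mul]
    simp only [Fin.sum_univ_two]
    have h00 := hy 0 0
    have h01 := hy 0 1
    have h10 := hy 1 0
    have h11 := hy 1 1
    have hx := hx i k
    simp only [qvec, one_ne_zero, zero_ne_one, and_false, and_true, and_self, if_true, if_false, 
      mul_zero, mul_one] at h00 h01 h10 h11
    linear_combination (toConv (ell hs 0 i) * toConv (ell hs 0 k)) x * h00 +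
      (toConv (ell hs 0 i) * toConv (ell hs 1 k)) x * h01 +
      (toConv (ell hs 1 i) * toConv (ell hs 0 k)) x * h10 +
      (toConv (ell hs 1 i) * toConv (ell hs 1 k)) x * h11 + counit y * hx
  | ha x y hx hy =>
    intro i k
    simp only [map_add]
    linear_combination hx i k + hy i k

theorem relations_r {q s : 𝕜ˣ} (hs : s ^ 2 = q) :
    Relations q (A := WithConv (SLq2 q →ₗ[𝕜] 𝕜)) fun i j => toConv (ell hs i j) := by
  have hq : (q : 𝕜) ≠ 0 := q.ne_zero
  have hR := fun b i k => ellell_right hs b i k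
  have hL := fun b i k => ellell_left hs b i k
  have q00 : qvec q 0 0 = 0 := by simp [qvec]
  have q01 : qvec q 0 1 = 1 := by simp [qvec]
  have q10 : qvec q 1 0 = -(q : 𝕜)⁻¹ := by simp [qvec]
  have q11 : qvec q 1 1 = 0 := by simp [qvec]
  set N : Fin 2 → Fin 2 → Fin 2 → Fin 2 → SLq2 q → 𝕜 :=
    fun i j k l b => (toConv (ell hs i j) * toConv (ell hs k l)) b with hN
  have hcb : ∀ b, N 1 0 0 1 b = N 0 1 1 0 b := fun b => by
    have h1 := hR b 0 1
    have h2 := hL b 0 1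
    rw [q01] at h1 h2
    have h3 : (q : 𝕜)⁻¹ * (N 1 0 0 1 b - N 0 1 1 0 b) = 0 := by linear_combination h1 - h2
    simpa [hq, sub_eq_zero] using h3
  constructor <;> refine WithConv.ext (LinearMap.ext fun b => ?_)
  · change N 0 1 0 0 b = q * N 0 0 0 1 b
    have h : N 0 0 0 1 b - (q : 𝕜)⁻¹ * N 0 1 0 0 b = counit b * qvec q 0 0 := hR b 0 0
    rw [q00] at h
    field_simp at h
    linear_combination -h
  · change N 1 0 0 0 b = q * N 0 0 1 0 b
    have h : N 0 0 1 0 b - (q : 𝕜)⁻¹ * N 1 0 0 0 b = counit b * qvec q 0 0 := hL b 0 0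
    rw [q00] at h
    field_simp at h
    linear_combination -h
  · change N 1 1 0 1 b = q * N 0 1 1 1 b
    have h : N 0 1 1 1 b - (q : 𝕜)⁻¹ * N 1 1 0 1 b = counit b * qvec q 1 1 := hL b 1 1
    rw [q11] at h
    field_simp at h
    linear_combination -h
  · change N 1 1 1 0 b = q * N 1 0 1 1 b
    have h : N 1 0 1 1 b - (q : 𝕜)⁻¹ * N 1 1 1 0 b = counit b * qvec q 1 1 := hR b 1 1
    rw [q11] at h
    field_simp at h
    linear_combination -h
  · exact hcb b
  · change N 0 0 1 1 b - N 1 1 0 0 b = ((q : 𝕜)⁻¹ - q) * N 0 1 1 0 b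
    have h1 : N 0 0 1 1 b - (q : 𝕜)⁻¹ * N 0 1 1 0 b = counit b * qvec q 0 1 := hR b 0 1
    have h2 : N 1 0 0 1 b - (q : 𝕜)⁻¹ * N 1 1 0 0 b = counit b * qvec q 1 0 := hR b 1 0
    rw [q01] at h1
    rw [q10, hcb] at h2
    have h3 : (q : 𝕜) * (q : 𝕜)⁻¹ = 1 := mul_inv_cancel₀ hq
    linear_combination h1 + q * h2 - (counit b - N 1 1 0 0 b) * h3
  · change N 0 0 1 1 b - (q : 𝕜)⁻¹ * N 0 1 1 0 b = counit b
    have h1 : N 0 0 1 1 b - (q : 𝕜)⁻¹ * N 0 1 1 0 b = counit b * qvec q 0 1 := hR b 0 1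
    rw [h1, q01, mul_one]

/-- The algebra map `a ↦ R (a ⊗ -)` to the convolution algebra. -/
def r {q s : 𝕜ˣ} (hs : s ^ 2 = q) : SLq2 q →ₐ[𝕜] WithConv (SLq2 q →ₗ[𝕜] 𝕜) :=
  lift _ (relations_r hs)

@[simp] theorem r_T {q s : 𝕜ˣ} (hs : s ^ 2 = q) (i j : Fin 2) :
    r hs (T q i j) = toConv (ell hs i j) := lift_T _ _ i j

/-- The linear map `R`. -/
def rForm {q s : 𝕜ˣ} (hs : s ^ 2 = q) : SLq2 q ⊗[𝕜] SLq2 q →ₗ[𝕜] 𝕜 :=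
  uncurryConv (r hs).toLinearMap

@[simp] theorem rForm_tmul {q s : 𝕜ˣ} (hs : s ^ 2 = q) (a b : SLq2 q) :
    rForm hs (a ⊗ₜ b) = r hs a b := rfl

/-- The convolution inverse of `R`, that is `R ∘ (S ⊗ id)`. -/
def rInv {q s : 𝕜ˣ} (hs : s ^ 2 = q) : SLq2 q ⊗[𝕜] SLq2 q →ₗ[𝕜] 𝕜 :=
  uncurryConv ((r hs).toLinearMap ∘ₗ S q)

theorem rForm_mul_rInv {q s : 𝕜ˣ} (hs : s ^ 2 = q) :
    toConv (rForm hs) * toConv (rInv hs) = 1 := by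
  refine WithConv.ext (TensorProduct.ext' fun a b => ?_)
  refine (convMul_uncurryConv _ _ a b).trans ?_
  have h : LinearMap.mul' 𝕜 (WithConv (SLq2 q →ₗ[𝕜] 𝕜)) (TensorProduct.map (r hs).toLinearMap
      ((r hs).toLinearMap ∘ₗ S q) (comul a)) =
      r hs (LinearMap.mul' 𝕜 _ ((S q).lTensor _ (comul a))) := by
    rw [← (ℛ 𝕜 a).eq]
    simp
  rw [h, mul_S, AlgHom.commutes]
  simp [mul_comm]

theorem rInv_mul_rForm {q s : 𝕜ˣ} (hs : s ^ 2 = q) :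
    toConv (rInv hs) * toConv (rForm hs) = 1 := by
  refine WithConv.ext (TensorProduct.ext' fun a b => ?_)
  refine (convMul_uncurryConv _ _ a b).trans ?_
  have h : LinearMap.mul' 𝕜 (WithConv (SLq2 q →ₗ[𝕜] 𝕜)) (TensorProduct.map
      ((r hs).toLinearMap ∘ₗ S q) (r hs).toLinearMap (comul a)) =
      r hs (LinearMap.mul' 𝕜 _ ((S q).rTensor _ (comul a))) := by
    rw [← (ℛ 𝕜 a).eq]
    simp
  rw [h, S_mul', AlgHom.commutes]
  simp [mul_comm]

theorem r_mul_left {q s : 𝕜ˣ} (hs : s ^ 2 = q) (a b c : SLq2 q) :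
    r hs (a * b) c =
      ∑ k ∈ (ℛ 𝕜 c).index, r hs a ((ℛ 𝕜 c).left k) * r hs b ((ℛ 𝕜 c).right k) := by
  rw [map_mul, (ℛ 𝕜 c).convMul_apply]

theorem r_one_left {q s : 𝕜ˣ} (hs : s ^ 2 = q) (c : SLq2 q) : r hs 1 c = counit c := by
  rw [map_one]; rfl

theorem r_one_right {q s : 𝕜ˣ} (hs : s ^ 2 = q) (a : SLq2 q) : r hs a 1 = counit a := by
  induction a using SLq2.induction with
  | hs t => rw [AlgHom.commutes]; simp
  | hT i j => simp [ell_one, counit_T]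
  | hm x y hx hy => rw [map_mul]; simp [hx, hy, Algebra.TensorProduct.one_def]
  | ha x y hx hy => rw [map_add]; simp [hx, hy]

theorem r_mul_right {q s : 𝕜ˣ} (hs : s ^ 2 = q) (a : SLq2 q) : ∀ b c : SLq2 q,
    r hs a (b * c) = LinearMap.mul' 𝕜 𝕜 (TensorProduct.map
      ((rForm hs) ∘ₗ (TensorProduct.mk 𝕜 _ _).flip c)
      ((rForm hs) ∘ₗ (TensorProduct.mk 𝕜 _ _).flip b) (comul a)) := by
  induction a using SLq2.induction with
  | hs t =>
    intro b c
    rw [AlgHom.commutes, Bialgebra.comul_algebraMap, Algebra.TensorProduct.algebraMap_apply]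
    simp
    ring
  | hT i j =>
    intro b c
    rw [comul_T]
    simp [ell_mul]
  | hm x y hx hy =>
    intro b c
    rw [map_mul (r hs), LinearMap.convMul_apply, Bialgebra.comul_mul, Bialgebra.comul_mul]
    simp only [← (ℛ 𝕜 x).eq, ← (ℛ 𝕜 y).eq] at hx hy ⊢
    rw [← (ℛ 𝕜 b).eq, ← (ℛ 𝕜 c).eq]
    simp only [Finset.sum_mul_sum, Algebra.TensorProduct.tmul_mul_tmul, map_sum,
      TensorProduct.map_tmul, LinearMap.mul'_apply, hx, hy, LinearMap.comp_apply,
      LinearMap.flip_apply, TensorProduct.mk_apply, rForm_tmul, r_mul_left]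
    refine (Finset.sum_congr rfl fun j _ => Finset.sum_comm.trans
      (Finset.sum_congr rfl fun i _ => Finset.sum_comm)).trans (Finset.sum_comm.trans
      (Finset.sum_congr rfl fun i _ => Finset.sum_comm.trans
      (Finset.sum_congr rfl fun l _ => Finset.sum_comm.trans
      (Finset.sum_congr rfl fun k _ => Finset.sum_congr rfl fun j _ => ?_))))
    ring
  | ha x y hx hy =>
    intro b c
    rw [map_add, map_add, map_add, map_add, ← hx, ← hy]
    rfl

/-- `a ↦ (b ↦ R (a ⊗ b) 1)`, an algebra map to the convolution algebra of endomorphisms. -/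
def rho {q s : 𝕜ˣ} (hs : s ^ 2 = q) : SLq2 q →ₐ[𝕜] WithConv (SLq2 q →ₗ[𝕜] SLq2 q) :=
  AlgHom.ofLinearMap
    { toFun := fun a => toConv (Algebra.linearMap 𝕜 (SLq2 q) ∘ₗ (r hs a).ofConv)
      map_add' := fun a b => by rw [map_add]; ext; simp
      map_smul' := fun t a => by 
        rw [map_smul]; ext x; exact (Algebra.linearMap 𝕜 (SLq2 q)).map_smul t _ }
    (by simp; rfl)
    (fun a b => by
      simp only [LinearMap.coe_mk, AddHom.coe_mk, map_mul]
      exact congrArg toConv (LinearMap.algHom_comp_convMul_distrib (Algebra.ofId 𝕜 (SLq2 q)) _ _))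

/-- `a ↦ (b ↦ ε(b) a)`, an algebra map to the convolution algebra of endomorphisms. -/
def kappa (q : 𝕜ˣ) : SLq2 q →ₐ[𝕜] WithConv (SLq2 q →ₗ[𝕜] SLq2 q) :=
  AlgHom.ofLinearMap
    { toFun := fun a => toConv ((counit : SLq2 q →ₗ[𝕜] 𝕜).smulRight a)
      map_add' := fun a b => by ext; simp
      map_smul' := fun t a => by ext x; exact smul_comm _ _ _ }
    (by ext; simp [Algebra.algebraMap_eq_smul_one])
    (fun a b => WithConv.ext (LinearMap.ext fun c => by
      simp only [LinearMap.coe_mk, AddHom.coe_mk]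
      rw [(ℛ 𝕜 c).convMul_apply]
      simp only [LinearMap.smulRight_apply, smul_mul_smul_comm, ← Finset.sum_smul]
      rw [sum_counit_left]))

theorem rho_mul_kappa {q s : 𝕜ˣ} (hs : s ^ 2 = q) (a a' b : SLq2 q) :
    (rho hs a * kappa q a') b = r hs a b • a' := by
  rw [(ℛ 𝕜 b).convMul_apply]
  have h := sum_counit_right (r hs a).ofConv b
  rw [← h, Finset.sum_smul]
  refine Finset.sum_congr rfl fun i _ => ?_
  simp [rho, kappa, Algebra.algebraMap_eq_smul_one, smul_smul, mul_comm]

theorem kappa_mul_rho {q s : 𝕜ˣ} (hs : s ^ 2 = q) (a a' b : SLq2 q) :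
    (kappa q a' * rho hs a) b = r hs a b • a' := by
  rw [(ℛ 𝕜 b).convMul_apply]
  have h := sum_counit_left (r hs a).ofConv b
  rw [← h, Finset.sum_smul]
  refine Finset.sum_congr rfl fun i _ => ?_
  simp [rho, kappa, Algebra.algebraMap_eq_smul_one, smul_smul, mul_comm]

theorem commute_rho_kappa {q s : 𝕜ˣ} (hs : s ^ 2 = q) (a a' : SLq2 q) :
    Commute (rho hs a) (kappa q a') :=
  WithConv.ext (LinearMap.ext fun b =>
    (rho_mul_kappa hs a a' b).trans (kappa_mul_rho hs a a' b).symm)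

/-- `a ↦ (b ↦ R(a₁ ⊗ b) a₂)`. -/
def Phi {q s : 𝕜ˣ} (hs : s ^ 2 = q) : SLq2 q →ₐ[𝕜] WithConv (SLq2 q →ₗ[𝕜] SLq2 q) :=
  (Algebra.TensorProduct.lift (rho hs) (kappa q) (commute_rho_kappa hs)).comp
    (Bialgebra.comulAlgHom 𝕜 (SLq2 q))

/-- `a ↦ (b ↦ R(a₂ ⊗ b) a₁)`. -/
def Phi' {q s : 𝕜ˣ} (hs : s ^ 2 = q) : SLq2 q →ₐ[𝕜] WithConv (SLq2 q →ₗ[𝕜] SLq2 q) :=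
  (Algebra.TensorProduct.lift (kappa q) (rho hs) fun a b => (commute_rho_kappa hs b a).symm).comp
    (Bialgebra.comulAlgHom 𝕜 (SLq2 q))

theorem Phi_apply {q s : 𝕜ˣ} (hs : s ^ 2 = q) (a b : SLq2 q) {ι : Type*} (ra : Repr 𝕜 a ι) :
    Phi hs a b = ∑ i ∈ ra.index, r hs (ra.left i) b • ra.right i := by
  rw [Phi, AlgHom.comp_apply, Bialgebra.comulAlgHom_apply, ← ra.eq]
  simp only [map_sum, Algebra.TensorProduct.lift_tmul, ofConv_sum, LinearMap.sum_apply,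
    rho_mul_kappa]

theorem Phi'_apply {q s : 𝕜ˣ} (hs : s ^ 2 = q) (a b : SLq2 q) {ι : Type*} (ra : Repr 𝕜 a ι) :
    Phi' hs a b = ∑ i ∈ ra.index, r hs (ra.right i) b • ra.left i := by
  rw [Phi', AlgHom.comp_apply, Bialgebra.comulAlgHom_apply, ← ra.eq]
  simp only [map_sum, Algebra.TensorProduct.lift_tmul, ofConv_sum, LinearMap.sum_apply,
    kappa_mul_rho]

/-- `b ↦ R(T i k ⊗ b₁) b₂`. -/
def xm {q s : 𝕜ˣ} (hs : s ^ 2 = q) (i k : Fin 2) : SLq2 q →ₗ[𝕜] SLq2 q :=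
  (TensorProduct.lid 𝕜 (SLq2 q)).toLinearMap ∘ₗ (ell hs i k).rTensor _ ∘ₗ comul

/-- `b ↦ b₁ R(T i k ⊗ b₂)`. -/
def ym {q s : 𝕜ˣ} (hs : s ^ 2 = q) (i k : Fin 2) : SLq2 q →ₗ[𝕜] SLq2 q :=
  (TensorProduct.rid 𝕜 (SLq2 q)).toLinearMap ∘ₗ (ell hs i k).lTensor _ ∘ₗ comul

theorem xm_apply {q s : 𝕜ˣ} (hs : s ^ 2 = q) (i k : Fin 2) (b : SLq2 q) :
    xm hs i k b = ∑ j ∈ (ℛ 𝕜 b).index, ell hs i k ((ℛ 𝕜 b).left j) • (ℛ 𝕜 b).right j := by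
  rw [xm, LinearMap.comp_apply, LinearMap.comp_apply, ← (ℛ 𝕜 b).eq]
  simp

theorem ym_apply {q s : 𝕜ˣ} (hs : s ^ 2 = q) (i k : Fin 2) (b : SLq2 q) :
    ym hs i k b = ∑ j ∈ (ℛ 𝕜 b).index, ell hs i k ((ℛ 𝕜 b).right j) • (ℛ 𝕜 b).left j := by
  rw [ym, LinearMap.comp_apply, LinearMap.comp_apply, ← (ℛ 𝕜 b).eq]
  simp

theorem xm_mul {q s : 𝕜ˣ} (hs : s ^ 2 = q) (i k : Fin 2) (b c : SLq2 q) :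
    xm hs i k (b * c) = ∑ m, xm hs m k b * xm hs i m c := by
  simp only [xm_apply hs _ _ b, xm_apply hs _ _ c]
  rw [xm, LinearMap.comp_apply, LinearMap.comp_apply, Bialgebra.comul_mul, ← (ℛ 𝕜 b).eq,
    ← (ℛ 𝕜 c).eq]
  simp only [Finset.sum_mul_sum, Algebra.TensorProduct.tmul_mul_tmul, smul_mul_smul_comm]
  simp only [map_sum, LinearMap.rTensor_tmul, ell_mul, LinearEquiv.coe_coe,
    TensorProduct.lid_tmul, Fin.sum_univ_two, ← Finset.sum_add_distrib, ← add_smul]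
  refine Finset.sum_congr rfl fun _ _ => Finset.sum_congr rfl fun _ _ => ?_
  congr 1
  ring

theorem ym_mul {q s : 𝕜ˣ} (hs : s ^ 2 = q) (i k : Fin 2) (b c : SLq2 q) :
    ym hs i k (b * c) = ∑ m, ym hs m k b * ym hs i m c := by
  simp only [ym_apply hs _ _ b, ym_apply hs _ _ c]
  rw [ym, LinearMap.comp_apply, LinearMap.comp_apply, Bialgebra.comul_mul, ← (ℛ 𝕜 b).eq,
    ← (ℛ 𝕜 c).eq]
  simp only [Finset.sum_mul_sum, Algebra.TensorProduct.tmul_mul_tmul, smul_mul_smul_comm]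
  simp only [map_sum, LinearMap.lTensor_tmul, ell_mul, LinearEquiv.coe_coe,
    TensorProduct.rid_tmul, Fin.sum_univ_two, ← Finset.sum_add_distrib, ← add_smul]
  refine Finset.sum_congr rfl fun _ _ => Finset.sum_congr rfl fun _ _ => ?_
  congr 1
  ring

theorem T_xm {q s : 𝕜ˣ} (hs : s ^ 2 = q) (b : SLq2 q) : ∀ i j : Fin 2,
    ∑ k, T q k j * xm hs i k b = ∑ k, ym hs k j b * T q i k := by
  induction b using SLq2.induction with
  | hs t =>
    intro i j
    fin_cases i <;> fin_cases j <;>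
    simp [xm, ym, Algebra.algebraMap_eq_smul_one, Algebra.TensorProduct.one_def, ell_one]
  | hT m n =>
    intro i j
    have hs0 : (s : 𝕜) ≠ 0 := s.ne_zero
    simp only [xm, ym, LinearMap.comp_apply, comul_T]
    have hq : (q : 𝕜) = s ^ 2 := by rw [← hs]; simp
    fin_cases i <;> fin_cases j <;> fin_cases m <;> fin_cases n <;>
    simp [ell_T, rVal, T_ba, T_ca, T_db, T_dc, T_cb, T_ad, T_da, smul_smul, hq] <;>
    match_scalars <;> field_simp <;> ring
  | hm x y hx hy =>
    intro i j
    have h : ∀ i j, T q 0 j * xm hs i 0 x + T q 1 j * xm hs i 1 x =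
        ym hs 0 j x * T q i 0 + ym hs 1 j x * T q i 1 := fun i j => by
      simpa only [Fin.sum_univ_two] using hx i j
    have h' : ∀ i j, T q 0 j * xm hs i 0 y + T q 1 j * xm hs i 1 y =
        ym hs 0 j y * T q i 0 + ym hs 1 j y * T q i 1 := fun i j => by
      simpa only [Fin.sum_univ_two] using hy i j
    simp only [xm_mul, ym_mul, Fin.sum_univ_two]
    calc _ = (T q 0 j * xm hs 0 0 x + T q 1 j * xm hs 0 1 x) * xm hs i 0 y +
          (T q 0 j * xm hs 1 0 x + T q 1 j * xm hs 1 1 x) * xm hs i 1 y := by noncomm_ring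
      _ = ym hs 0 j x * (T q 0 0 * xm hs i 0 y + T q 1 0 * xm hs i 1 y) +
          ym hs 1 j x * (T q 0 1 * xm hs i 0 y + T q 1 1 * xm hs i 1 y) := by
        rw [h, h]; noncomm_ring
      _ = _ := by rw [h', h']; noncomm_ring
  | ha x y hx hy =>
    intro i j
    simp only [map_add, mul_add, add_mul, Finset.sum_add_distrib, hx, hy]

theorem Phi_mul_id {q s : 𝕜ˣ} (hs : s ^ 2 = q) (a : SLq2 q) :
    Phi hs a * toConv LinearMap.id = toConv LinearMap.id * Phi' hs a := by
  induction a using SLq2.induction with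
  | hs t => rw [AlgHom.commutes, AlgHom.commutes, Algebra.commutes]
  | hT i j =>
    refine WithConv.ext (LinearMap.ext fun b => ?_)
    let ra : Repr 𝕜 (T q i j) (Fin 2) :=
      ⟨Finset.univ, fun k => T q i k, fun k => T q k j, (comul_T q i j).symm⟩
    rw [(ℛ 𝕜 b).convMul_apply, (ℛ 𝕜 b).convMul_apply]
    simp only [Phi_apply hs _ _ ra, Phi'_apply hs _ _ ra]
    have h := T_xm hs b i j
    simp only [xm_apply, ym_apply, Finset.mul_sum, Finset.sum_mul] at h
    rw [Finset.sum_comm, Finset.sum_comm (s := Finset.univ) (t := (ℛ 𝕜 b).index)] at h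
    simpa [ra, add_mul, mul_add] using h
  | hm x y hx hy => rw [map_mul, map_mul, mul_assoc, hy, ← mul_assoc, hx, mul_assoc]
  | ha x y hx hy => rw [map_add, map_add, add_mul, mul_add, hx, hy]

/-- The coquasitriangular structure of `SL_q(2)`, the universal `R`-form with values `rVal` on
pairs of generators (see `R_form_T`). -/
def R {q s : 𝕜ˣ} (hs : s ^ 2 = q) : UniversalRForm 𝕜 (SLq2 q) where
  unit := ⟨toConv (rForm hs), toConv (rInv hs), rForm_mul_rInv hs, rInv_mul_rForm hs⟩
  conv_mul := by
    refine WithConv.ext (TensorProduct.ext' fun a b => ?_)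
    have h := congrArg (fun f => f.ofConv b) (Phi_mul_id hs a)
    simp only [(ℛ 𝕜 b).convMul_apply, Phi_apply hs _ _ (ℛ 𝕜 a), Phi'_apply hs _ _ (ℛ 𝕜 a),
      Finset.sum_mul, Finset.mul_sum] at h
    rw [convMul_tmul _ _ a b (ℛ 𝕜 a) (ℛ 𝕜 b), convMul_tmul _ _ a b (ℛ 𝕜 a) (ℛ 𝕜 b),
      Finset.sum_comm, Finset.sum_comm (s := (ℛ 𝕜 a).index)]
    simpa [Algebra.algebraMap_eq_smul_one] using h
  comp_idTensorMul := by
    refine WithConv.ext (TensorProduct.ext' fun a bc => ?_)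
    induction bc with
    | zero => simp
    | add x y hx hy => rw [TensorProduct.tmul_add, map_add, map_add, hx, hy]
    | tmul b c =>
      refine Eq.trans ?_ (leg13_convMul_leg12 _ _ a b c).symm
      refine (r_mul_right hs a b c).trans ?_
      conv_lhs => rw [← (ℛ 𝕜 a).eq]
      simp
  comp_mulTensorId := by
    refine WithConv.ext (TensorProduct.ext' fun a bc => ?_)
    induction bc with
    | zero => simp
    | add x y hx hy => rw [TensorProduct.tmul_add, map_add, map_add, hx, hy]
    | tmul b c =>
      refine Eq.trans ?_ (leg13_convMul_leg23 _ _ a b c).symm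
      exact r_mul_left hs a b c

theorem R_form_T {q s : 𝕜ˣ} (hs : s ^ 2 = q) (i j k l : Fin 2) :
    (R hs).form (T q i j ⊗ₜ T q k l) = rVal q s i j k l := by
  change r hs (T q i j) (T q k l) = _
  rw [r_T]
  exact ell_T hs i j k l

end SLq2

end

/-!
Slicing the two conjugation formulas for an infinitesimal `R`-form `χ` shows that, in each variable,
the elements on which `χ` vanishes form a subalgebra, so `χ` is determined by its matrix on `V ⊗ V`,
where `V` is the comodule with coefficients `T`. Since `χ` commutes with the multiplication, this
matrix commutes with the action of the functionals `R(α ⊗ -)`, `R(β ⊗ -)` and `R(- ⊗ γ)`, that is,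
of the generators of `U_q(sl₂)`. It therefore lies in the Temperley–Lieb algebra: it is
`x • 1 + y • (v ⊗ v)`, with `v` the invariant vector of `V ⊗ V`. Expanding `χ (T i i ⊗ αδ)` with the
determinant relation `αδ = 1 + q⁻¹ • βγ` gives `2 x + y = 0` for `i = 0` and `2 x + q⁻² y = 0` for
`i = 1`, whence `y = 0` as `q² ≠ 1`, and then `x = 0` as `2 ≠ 0`.
-/

section Slices

open Coalgebra WithConv TensorProduct

variable {R C D A : Type*} [CommSemiring R] [AddCommMonoid C] [Module R C] [Coalgebra R C]
  [AddCommMonoid D] [Module R D] [Coalgebra R D] [Semiring A] [Algebra R A]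

theorem curry_convMul (f g : WithConv (C ⊗[R] D →ₗ[R] A)) {c : C} {ι : Type*} (rc : Repr R c ι) :
    toConv (curry (f * g).ofConv c) = ∑ i ∈ rc.index,
      toConv (curry f.ofConv (rc.left i)) * toConv (curry g.ofConv (rc.right i)) := by
  ext d
  simp only [ofConv_sum, LinearMap.sum_apply, (ℛ R d).convMul_apply, curry_apply,
    LinearMap.convMul_apply, comul_tmul]
  rw [← rc.eq, ← (ℛ R d).eq]
  simp only [sum_tmul, tmul_sum, map_sum, AlgebraTensorModule.tensorTensorTensorComm_tmul,
    TensorProduct.map_tmul, LinearMap.mul'_apply]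
  exact Finset.sum_comm

theorem curry_flip_convMul (f g : WithConv (C ⊗[R] D →ₗ[R] A)) {d : D} {ι : Type*}
    (rd : Repr R d ι) :
    toConv ((curry (f * g).ofConv).flip d) = ∑ i ∈ rd.index,
      toConv ((curry f.ofConv).flip (rd.left i)) *
        toConv ((curry g.ofConv).flip (rd.right i)) := by
  ext c
  simp only [ofConv_sum, LinearMap.sum_apply, (ℛ R c).convMul_apply, curry_apply,
    LinearMap.convMul_apply, comul_tmul, LinearMap.flip_apply]
  rw [← rd.eq, ← (ℛ R c).eq]
  simp only [sum_tmul, tmul_sum, map_sum, AlgebraTensorModule.tensorTensorTensorComm_tmul,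
    TensorProduct.map_tmul, LinearMap.mul'_apply]

theorem sum_smul_counit {c : C} {ι : Type*} (rc : Repr R c ι) :
    ∑ i ∈ rc.index, counit (R := R) (rc.right i) • rc.left i = c := by
  simpa only [map_sum, TensorProduct.rid_tmul, one_smul] using
    congrArg (TensorProduct.rid R C) (sum_tmul_counit_eq rc)

/-- A square matrix over a coalgebra is *multiplicative* if `Δ(tᵢⱼ) = ∑ₖ tᵢₖ ⊗ tₖⱼ`. The condition
`ε(tᵢⱼ) = δᵢⱼ`, which makes it the coefficient matrix of a comodule, is not part of the
definition. -/
def IsMultiplicativeMatrix (R : Type*) {C n : Type*} [CommSemiring R] [AddCommMonoid C] [Module R C]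
    [Coalgebra R C] [Fintype n] (t : Matrix n n C) : Prop :=
  ∀ i j, comul (R := R) (t i j) = ∑ k, t i k ⊗ₜ[R] t k j

namespace IsMultiplicativeMatrix

variable {n : Type*} [Fintype n] {t : Matrix n n C}

theorem curry_convMul (ht : IsMultiplicativeMatrix R t) (f g : WithConv (C ⊗[R] D →ₗ[R] A))
    (i j : n) :
    toConv (curry (f * g).ofConv (t i j)) =
      ∑ k, toConv (curry f.ofConv (t i k)) * toConv (curry g.ofConv (t k j)) :=
  _root_.curry_convMul f g ⟨Finset.univ, (t i ·), (t · j), (ht i j).symm⟩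

theorem convMul_convMul_tmul_eq_zero (ht : IsMultiplicativeMatrix R t)
    (f : WithConv (C ⊗[R] D →ₗ[R] A)) {g : WithConv (C ⊗[R] D →ₗ[R] A)}
    (hg : ∀ i j d, g (t i j ⊗ₜ d) = 0) (h : WithConv (C ⊗[R] D →ₗ[R] A)) (i j : n) (d : D) :
    (f * g * h) (t i j ⊗ₜ d) = 0 := by
  have hslice (i j : n) : curry g.ofConv (t i j) = 0 := LinearMap.ext (hg i j)
  have hmul : toConv (curry (f * g * h).ofConv (t i j)) = 0 := by simp [ht.curry_convMul, hslice]
  exact LinearMap.congr_fun (congrArg ofConv hmul) d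

theorem convMul_tmul (ht : IsMultiplicativeMatrix R t) {m : Type*} [Fintype m] {u : Matrix m m D}
    (hu : IsMultiplicativeMatrix R u) (f g : WithConv (C ⊗[R] D →ₗ[R] A)) (i j : n) (k l : m) :
    (f * g) (t i j ⊗ₜ u k l) = ∑ o, ∑ p, f (t i o ⊗ₜ u k p) * g (t o j ⊗ₜ u p l) := by
  let ru : Repr R (u k l) m := ⟨Finset.univ, (u k ·), (u · l), (hu k l).symm⟩
  simpa [ru.convMul_apply, ru] using
    LinearMap.congr_fun (congrArg ofConv (ht.curry_convMul f g i j)) (u k l)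

end IsMultiplicativeMatrix

end Slices

section Bialgebra

open Coalgebra WithConv TensorProduct

variable {𝕜 H : Type*} [Field 𝕜] [Ring H] [Bialgebra 𝕜 H]

theorem curry_leg23 (f : H ⊗[𝕜] H →ₗ[𝕜] 𝕜) (a : H) :
    toConv (curry (leg23 f) a) = counit (R := 𝕜) a • toConv f := by
  ext b c
  simp

theorem curry_leg23_convMul (f : H ⊗[𝕜] H →ₗ[𝕜] 𝕜)
    (g : WithConv (H ⊗[𝕜] (H ⊗[𝕜] H) →ₗ[𝕜] 𝕜)) (a : H) :
    toConv (curry (toConv (leg23 f) * g).ofConv a) = toConv f * toConv (curry g.ofConv a) := by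
  conv_rhs => rw [← sum_counit_smul (ℛ 𝕜 a)]
  simp [curry_convMul _ _ (ℛ 𝕜 a), curry_leg23, Finset.mul_sum, mul_smul_comm]

theorem curry_convMul_leg23 (f : WithConv (H ⊗[𝕜] (H ⊗[𝕜] H) →ₗ[𝕜] 𝕜))
    (g : H ⊗[𝕜] H →ₗ[𝕜] 𝕜) (a : H) :
    toConv (curry (f * toConv (leg23 g)).ofConv a) = toConv (curry f.ofConv a) * toConv g := by
  conv_rhs => rw [← sum_smul_counit (ℛ 𝕜 a)]
  simp [curry_convMul _ _ (ℛ 𝕜 a), curry_leg23, Finset.sum_mul, smul_mul_assoc]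

/-- The third-variable slices `c ↦ f (- ⊗ - ⊗ c)` of a form on `H ⊗ H ⊗ H`; the first-variable
slices are `TensorProduct.curry f`. -/
def curryThird (f : H ⊗[𝕜] (H ⊗[𝕜] H) →ₗ[𝕜] 𝕜) : H →ₗ[𝕜] H ⊗[𝕜] H →ₗ[𝕜] 𝕜 :=
  (curry (f ∘ₗ (TensorProduct.assoc 𝕜 H H H).toLinearMap)).flip

@[simp] theorem curryThird_apply (f : H ⊗[𝕜] (H ⊗[𝕜] H) →ₗ[𝕜] 𝕜) (a b c : H) :
    curryThird f c (a ⊗ₜ b) = f (a ⊗ₜ (b ⊗ₜ c)) := rfl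

theorem curryThird_convMul (f g : WithConv (H ⊗[𝕜] (H ⊗[𝕜] H) →ₗ[𝕜] 𝕜)) {c : H} {ι : Type*}
    (rc : Repr 𝕜 c ι) :
    toConv (curryThird (f * g).ofConv c) = ∑ i ∈ rc.index,
      toConv (curryThird f.ofConv (rc.left i)) * toConv (curryThird g.ofConv (rc.right i)) := by
  rw [curryThird, ← toConv_ofConv f, ← toConv_ofConv g]
  exact (congrArg (fun h => toConv ((curry h).flip c)) (LinearMap.convMul_comp_coalgHom_distrib f g
    (Coalgebra.TensorProduct.assoc 𝕜 𝕜 H H H).toCoalgHom)).trans (curry_flip_convMul _ _ rc)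

theorem curryThird_leg12 (f : H ⊗[𝕜] H →ₗ[𝕜] 𝕜) (c : H) :
    toConv (curryThird (leg12 f) c) = counit (R := 𝕜) c • toConv f := by
  ext a b
  simp [mul_comm]

theorem curryThird_leg12_convMul (f : H ⊗[𝕜] H →ₗ[𝕜] 𝕜)
    (g : WithConv (H ⊗[𝕜] (H ⊗[𝕜] H) →ₗ[𝕜] 𝕜)) (c : H) :
    toConv (curryThird (toConv (leg12 f) * g).ofConv c) =
      toConv f * toConv (curryThird g.ofConv c) := by
  conv_rhs => rw [← sum_counit_smul (ℛ 𝕜 c)]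
  simp [curryThird_convMul _ _ (ℛ 𝕜 c), curryThird_leg12, Finset.mul_sum, mul_smul_comm]

theorem curryThird_convMul_leg12 (f : WithConv (H ⊗[𝕜] (H ⊗[𝕜] H) →ₗ[𝕜] 𝕜))
    (g : H ⊗[𝕜] H →ₗ[𝕜] 𝕜) (c : H) :
    toConv (curryThird (f * toConv (leg12 g)).ofConv c) =
      toConv (curryThird f.ofConv c) * toConv g := by
  conv_rhs => rw [← sum_smul_counit (ℛ 𝕜 c)]
  simp [curryThird_convMul _ _ (ℛ 𝕜 c), curryThird_leg12, Finset.sum_mul, smul_mul_assoc]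

theorem isInfinitesimalRForm_zero (R : UniversalRForm 𝕜 H) :
    IsInfinitesimalRForm R 0 := by
  have h12 : leg12 (0 : H ⊗[𝕜] H →ₗ[𝕜] 𝕜) = 0 := by simp [leg12]
  have h23 : leg23 (0 : H ⊗[𝕜] H →ₗ[𝕜] 𝕜) = 0 := by simp [leg23]
  have h13 : leg13 (0 : H ⊗[𝕜] H →ₗ[𝕜] 𝕜) = 0 := by simp [leg13, h23]
  constructor <;> simp [h12, h23, h13]

namespace IsInfinitesimalRForm

variable {R : UniversalRForm 𝕜 H} {χ : H ⊗[𝕜] H →ₗ[𝕜] 𝕜}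

theorem commute_comp_mul (hχ : IsInfinitesimalRForm R χ) (φ : H →ₗ[𝕜] 𝕜) :
    Commute (toConv χ) (toConv (φ ∘ₗ LinearMap.mul' 𝕜 H)) := by
  have h := congrArg (fun f => toConv (φ ∘ₗ f.ofConv)) hχ.conv_mul
  ext a b
  simpa [convMul_tmul _ _ a b (ℛ 𝕜 a) (ℛ 𝕜 b), ← Algebra.smul_def, ← Algebra.commutes, mul_comm]
    using LinearMap.congr_fun (congrArg ofConv h) (a ⊗ₜ b)

theorem curry_comp_mulTensorId (hχ : IsInfinitesimalRForm R χ) (a : H) :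
    toConv (curry (χ ∘ₗ mulTensorId 𝕜 H) a) = counit (R := 𝕜) a • toConv χ +
      ↑R.unit⁻¹ * toConv (curry (leg13 χ) a) * ↑R.unit := by
  calc toConv (curry (χ ∘ₗ mulTensorId 𝕜 H) a)
    _ = toConv (curry (leg23 χ) a) + toConv (curry (toConv (leg23 R.invForm) * toConv (leg13 χ) *
          toConv (leg23 R.form)).ofConv a) := by
      rw [← ofConv_toConv (χ ∘ₗ mulTensorId 𝕜 H), hχ.comp_mulTensorId]; rfl
    _ = _ := by rw [curry_leg23, curry_convMul_leg23, curry_leg23_convMul]; rfl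

theorem curryThird_comp_idTensorMul (hχ : IsInfinitesimalRForm R χ) (c : H) :
    toConv (curryThird (χ ∘ₗ idTensorMul 𝕜 H) c) = counit (R := 𝕜) c • toConv χ +
      ↑R.unit⁻¹ * toConv (curryThird (leg13 χ) c) * ↑R.unit := by
  calc toConv (curryThird (χ ∘ₗ idTensorMul 𝕜 H) c)
    _ = toConv (curryThird (leg12 χ) c) + toConv (curryThird (toConv (leg12 R.invForm) *
          toConv (leg13 χ) * toConv (leg12 R.form)).ofConv c) := by
      rw [← ofConv_toConv (χ ∘ₗ idTensorMul 𝕜 H), hχ.comp_idTensorMul]; rfl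
    _ = _ := by rw [curryThird_leg12, curryThird_convMul_leg12, curryThird_leg12_convMul]; rfl

theorem apply_one_tmul (hχ : IsInfinitesimalRForm R χ) (c : H) : χ (1 ⊗ₜ c) = 0 := by
  have hslice : curry (χ ∘ₗ mulTensorId 𝕜 H) 1 = χ := by ext; simp [mulTensorId]
  have h := hχ.curry_comp_mulTensorId 1
  rw [hslice, Bialgebra.counit_one, one_smul, left_eq_add, Units.mul_left_eq_zero,
    Units.mul_right_eq_zero] at h
  simpa using LinearMap.congr_fun (congrArg ofConv h) (1 ⊗ₜ c)

theorem apply_tmul_one (hχ : IsInfinitesimalRForm R χ) (a : H) : χ (a ⊗ₜ 1) = 0 := by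
  have hslice : curryThird (χ ∘ₗ idTensorMul 𝕜 H) 1 = χ := by ext; simp [idTensorMul]
  have h := hχ.curryThird_comp_idTensorMul 1
  rw [hslice, Bialgebra.counit_one, one_smul, left_eq_add, Units.mul_left_eq_zero,
    Units.mul_right_eq_zero] at h
  simpa using LinearMap.congr_fun (congrArg ofConv h) (a ⊗ₜ 1)

theorem apply_mul_tmul_eq_zero (hχ : IsInfinitesimalRForm R χ) {a b : H}
    (ha : ∀ c, χ (a ⊗ₜ c) = 0) (hb : ∀ c, χ (b ⊗ₜ c) = 0) (c : H) : χ ((a * b) ⊗ₜ c) = 0 := by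
  have hslice : toConv (curry (leg13 χ) a) = 0 := by ext; simp [ha]
  have h := hχ.curry_comp_mulTensorId a
  rw [hslice, mul_zero, zero_mul, add_zero] at h
  simpa [mulTensorId, hb] using LinearMap.congr_fun (congrArg ofConv h) (b ⊗ₜ c)

theorem form_mul_curryThird_comp_idTensorMul (hχ : IsInfinitesimalRForm R χ) (c : H) :
    toConv R.form * toConv (curryThird (χ ∘ₗ idTensorMul 𝕜 H) c) =
      counit (R := 𝕜) c • (toConv R.form * toConv χ) +
        toConv (curryThird (leg13 χ) c) * toConv R.form := by
  have hform : toConv R.form = ↑R.unit := rfl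
  rw [hform, hχ.curryThird_comp_idTensorMul, mul_add, mul_smul_comm, mul_assoc,
    Units.mul_inv_cancel_left]

variable {n : Type*} [Fintype n] {t : Matrix n n H}

theorem sum_apply_mul_comm (hχ : IsInfinitesimalRForm R χ) (ht : IsMultiplicativeMatrix 𝕜 t)
    (φ : H →ₗ[𝕜] 𝕜) (i j k l : n) :
    ∑ o, ∑ p, χ (t i o ⊗ₜ t k p) * φ (t o j * t p l) =
      ∑ o, ∑ p, φ (t i o * t k p) * χ (t o j ⊗ₜ t p l) := by
  have hleft := ht.convMul_tmul ht (toConv χ) (toConv (φ ∘ₗ LinearMap.mul' 𝕜 H)) i j k l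
  have hright := ht.convMul_tmul ht (toConv (φ ∘ₗ LinearMap.mul' 𝕜 H)) (toConv χ) i j k l
  rw [(hχ.commute_comp_mul φ).eq] at hleft
  exact hleft.symm.trans hright

theorem apply_tmul_mul_eq_zero (hχ : IsInfinitesimalRForm R χ) (ht : IsMultiplicativeMatrix 𝕜 t)
    {b c : H} (hb : ∀ i j, χ (t i j ⊗ₜ b) = 0) (hc : ∀ i j, χ (t i j ⊗ₜ c) = 0) (i j : n) :
    χ (t i j ⊗ₜ (b * c)) = 0 := by
  have hconj := ht.convMul_convMul_tmul_eq_zero ↑R.unit⁻¹ (g := toConv (curryThird (leg13 χ) c))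
    (by simp [hc]) R.unit i j b
  calc χ (t i j ⊗ₜ (b * c))
    _ = counit c * χ (t i j ⊗ₜ b) +
          (↑R.unit⁻¹ * toConv (curryThird (leg13 χ) c) * ↑R.unit) (t i j ⊗ₜ b) :=
      LinearMap.congr_fun (congrArg ofConv (hχ.curryThird_comp_idTensorMul c)) (t i j ⊗ₜ b)
    _ = 0 := by rw [hb, hconj, mul_zero, add_zero]

theorem eq_zero_of_adjoin_eq_top (hχ : IsInfinitesimalRForm R χ)
    (ht : IsMultiplicativeMatrix 𝕜 t)
    (hgen : Algebra.adjoin 𝕜 (Set.range (Function.uncurry t)) = ⊤)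
    (hzero : ∀ i j k l, χ (t i j ⊗ₜ t k l) = 0) : χ = 0 := by
  have hmem (a : H) : a ∈ Algebra.adjoin 𝕜 (Set.range (Function.uncurry t)) :=
    hgen ▸ Algebra.mem_top
  have hleft (b : H) : ∀ i j, χ (t i j ⊗ₜ b) = 0 := by
    induction hmem b using Algebra.adjoin_induction with
    | mem b hb => obtain ⟨⟨k, l⟩, rfl⟩ := hb; exact fun i j => hzero i j k l
    | algebraMap r => simp [Algebra.algebraMap_eq_smul_one, hχ.apply_tmul_one]
    | add b c _ _ hb hc => simp [tmul_add, hb, hc]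
    | mul b c _ _ hb hc => exact hχ.apply_tmul_mul_eq_zero ht hb hc
  ext a c
  induction hmem a using Algebra.adjoin_induction generalizing c with
  | mem a ha => obtain ⟨⟨i, j⟩, rfl⟩ := ha; exact hleft c i j
  | algebraMap r => simp [Algebra.algebraMap_eq_smul_one, hχ.apply_one_tmul]
  | add a b _ _ ha hb => simp_all
  | mul a b _ _ ha hb => exact hχ.apply_mul_tmul_eq_zero ha hb c

end IsInfinitesimalRForm

end Bialgebra

namespace SLq2

open TensorProduct WithConv

variable {𝕜 : Type*} [Field 𝕜] {q s : 𝕜ˣ}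

theorem isMultiplicativeMatrix_T (q : 𝕜ˣ) : IsMultiplicativeMatrix 𝕜 (Matrix.of (T q)) :=
  comul_T q

theorem adjoin_range_T (q : 𝕜ˣ) :
    Algebra.adjoin 𝕜 (Set.range (Function.uncurry (T q))) = ⊤ := by
  refine eq_top_iff.2 fun a _ => ?_
  induction a using SLq2.induction with
  | hs r => exact algebraMap_mem _ r
  | hT i j => exact Algebra.subset_adjoin ⟨(i, j), rfl⟩
  | hm a b ha hb => exact mul_mem (ha trivial) (hb trivial)
  | ha a b ha hb => exact add_mem (ha trivial) (hb trivial)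

theorem R_form_T_tmul_T_zero (hs : s ^ 2 = q) (i j l : Fin 2) :
    (R hs).form (T q i j ⊗ₜ T q 0 l) = if i = j ∧ l = 0 then rVal q s i i 0 0 else 0 := by
  simp only [R_form_T, rVal]
  fin_cases i <;> fin_cases j <;> fin_cases l <;> simp

theorem rVal_diag_ne_zero (q s : 𝕜ˣ) (i k : Fin 2) : rVal q s i i k k ≠ 0 := by
  by_cases h : i = k <;> simp [rVal, h]

theorem R_form_convMul_T_tmul_T_zero (hs : s ^ 2 = q)
    (f : WithConv (SLq2 q ⊗[𝕜] SLq2 q →ₗ[𝕜] 𝕜)) (i j l : Fin 2) :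
    (toConv (R hs).form * f) (T q i j ⊗ₜ T q 0 l) = rVal q s i i 0 0 * f (T q i j ⊗ₜ T q 0 l) := by
  have hT := isMultiplicativeMatrix_T q
  refine (hT.convMul_tmul hT _ f i j 0 l).trans ?_
  simp [R_form_T_tmul_T_zero, ite_and]

section

variable {hs : s ^ 2 = q} {χ : SLq2 q ⊗[𝕜] SLq2 q →ₗ[𝕜] 𝕜}

theorem apply_T_tmul_T_zero_mul (hχ : IsInfinitesimalRForm (R hs) χ) (i l : Fin 2) (c : SLq2 q) :
    χ (T q i i ⊗ₜ (T q 0 l * c)) =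
      Coalgebra.counit c * χ (T q i i ⊗ₜ T q 0 l) + if l = 0 then χ (T q i i ⊗ₜ c) else 0 := by
  have hT := isMultiplicativeMatrix_T q
  have hright : (toConv (curryThird (leg13 χ) c) * toConv (R hs).form) (T q i i ⊗ₜ T q 0 l) =
      rVal q s i i 0 0 * if l = 0 then χ (T q i i ⊗ₜ c) else 0 := by
    refine (hT.convMul_tmul hT _ _ i i 0 l).trans ?_
    simp [R_form_T_tmul_T_zero, counit_T, ite_and, mul_comm]
  have h := LinearMap.congr_fun (congrArg ofConv (hχ.form_mul_curryThird_comp_idTensorMul c))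
    (T q i i ⊗ₜ T q 0 l)
  rw [R_form_convMul_T_tmul_T_zero] at h
  refine mul_left_cancel₀ (rVal_diag_ne_zero q s i 0) (h.trans ?_)
  rw [ofConv_add, LinearMap.add_apply, hright, ofConv_smul, LinearMap.smul_apply,
    R_form_convMul_T_tmul_T_zero, smul_eq_mul]
  ring

theorem apply_T_tmul_T_trace (hχ : IsInfinitesimalRForm (R hs) χ) (i : Fin 2) :
    χ (T q i i ⊗ₜ T q 0 0) + χ (T q i i ⊗ₜ T q 1 1) = 0 := by
  have h := apply_T_tmul_T_zero_mul hχ i 0 (T q 1 1)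
  rw [T_ad, tmul_add, tmul_smul, map_add, map_smul, hχ.apply_tmul_one,
    apply_T_tmul_T_zero_mul hχ i 1 (T q 1 0)] at h
  simpa [counit_T] using h.symm

theorem ell_zero_zero_T_mul_T (hs : s ^ 2 = q) (i j k l : Fin 2) :
    ell hs 0 0 (T q i j * T q k l) =
      if i = j ∧ k = l then rVal q s 0 0 k k * rVal q s 0 0 i i else 0 := by
  simp only [ell_mul, ell_T, Fin.sum_univ_two, rVal]
  fin_cases i <;> fin_cases j <;> fin_cases k <;> fin_cases l <;> simp

theorem sub_inv_ne_zero (hq₁ : q ≠ 1) (hq₂ : q ≠ -1) : (q : 𝕜) - (q : 𝕜)⁻¹ ≠ 0 := by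
  rw [sub_ne_zero, Ne, self_eq_inv₀]
  rintro (h | h | h)
  exacts [hq₂ (Units.ext h), q.ne_zero h, hq₁ (Units.ext h)]

theorem rVal_mul_rVal_ne (hq₁ : q ≠ 1) (hq₂ : q ≠ -1) {i j k l : Fin 2}
    (hne : (i : ℕ) + k ≠ j + l) :
    rVal q s 0 0 k k * rVal q s 0 0 i i ≠ rVal q s 0 0 l l * rVal q s 0 0 j j := by
  have hsq : (s : 𝕜)⁻¹ * q * ((s : 𝕜)⁻¹ * q) ≠ (s : 𝕜)⁻¹ * (s : 𝕜)⁻¹ := by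
    have hq : (q : 𝕜) * q ≠ 1 := fun h =>
      sub_inv_ne_zero hq₁ hq₂ (sub_eq_zero.2 (eq_inv_of_mul_eq_one_left h))
    rw [mul_mul_mul_comm]
    exact mul_right_eq_self₀.not.2 (not_or.2 ⟨hq, by simp⟩)
  fin_cases i <;> fin_cases j <;> fin_cases k <;> fin_cases l <;>
    simp [rVal, hq₁, hsq, hsq.symm] at hne ⊢

theorem apply_T_tmul_T_eq_zero_of_ne (hχ : IsInfinitesimalRForm (R hs) χ) (hq₁ : q ≠ 1)
    (hq₂ : q ≠ -1) {i j k l : Fin 2} (hne : (i : ℕ) + k ≠ j + l) : χ (T q i j ⊗ₜ T q k l) = 0 := by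
  have h := hχ.sum_apply_mul_comm (isMultiplicativeMatrix_T q) (ell hs 0 0) i j k l
  simp only [Matrix.of_apply, ell_zero_zero_T_mul_T, ite_and, mul_ite, mul_zero, ite_mul, zero_mul,
    Finset.sum_ite_eq, Finset.sum_ite_eq', Finset.mem_univ, if_true, Finset.sum_const_zero,
    Finset.sum_ite_irrel] at h
  rw [mul_comm] at h
  by_contra hX
  exact rVal_mul_rVal_ne hq₁ hq₂ hne (mul_right_cancel₀ hX h).symm

theorem ell_zero_one_T_mul_T (hs : s ^ 2 = q) (i j k l : Fin 2) :
    ell hs 0 1 (T q i j * T q k l) = (s : 𝕜)⁻¹ * (s : 𝕜)⁻¹ * (q - (q : 𝕜)⁻¹) *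
      if i = 1 ∧ j = 0 ∧ k = l then (if k = 0 then (q : 𝕜) else 1)
      else if k = 1 ∧ l = 0 ∧ i = j then (if i = 0 then 1 else (q : 𝕜)) else 0 := by
  simp only [ell_mul, ell_T, Fin.sum_univ_two, rVal]
  fin_cases i <;> fin_cases j <;> fin_cases k <;> fin_cases l <;> simp [mul_comm, mul_left_comm]

theorem rForm_T_mul_T_tmul_T_one_zero (hs : s ^ 2 = q) (i j k l : Fin 2) :
    rForm hs ((T q i j * T q k l) ⊗ₜ T q 1 0) = (s : 𝕜)⁻¹ * (s : 𝕜)⁻¹ * (q - (q : 𝕜)⁻¹) *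
      if i = 0 ∧ j = 1 ∧ k = l then (if k = 0 then (q : 𝕜) else 1)
      else if k = 0 ∧ l = 1 ∧ i = j then (if i = 0 then 1 else (q : 𝕜)) else 0 := by
  have hexpand : rForm hs ((T q i j * T q k l) ⊗ₜ T q 1 0) =
      ∑ o, rVal q s i j 1 o * rVal q s k l o 0 := by
    simp [rForm, uncurryConv, LinearMap.convMul_apply, comul_T, ell_T]
  rw [hexpand]
  simp only [Fin.sum_univ_two, rVal]
  fin_cases i <;> fin_cases j <;> fin_cases k <;> fin_cases l <;> simp [mul_comm, mul_left_comm]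

theorem apply_T_tmul_T_relations (hχ : IsInfinitesimalRForm (R hs) χ) (hq₁ : q ≠ 1)
    (hq₂ : q ≠ -1) :
    χ (T q 0 0 ⊗ₜ T q 1 1) + q * χ (T q 0 1 ⊗ₜ T q 1 0) = χ (T q 0 0 ⊗ₜ T q 0 0) ∧
      χ (T q 1 0 ⊗ₜ T q 0 1) + q * χ (T q 1 1 ⊗ₜ T q 0 0) = q * χ (T q 0 0 ⊗ₜ T q 0 0) ∧
      χ (T q 1 1 ⊗ₜ T q 1 1) = χ (T q 0 0 ⊗ₜ T q 1 1) + q * χ (T q 1 0 ⊗ₜ T q 0 1) ∧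
      χ (T q 0 0 ⊗ₜ T q 0 0) = χ (T q 0 0 ⊗ₜ T q 1 1) + q * χ (T q 1 0 ⊗ₜ T q 0 1) := by
  have hc : (s : 𝕜)⁻¹ * (s : 𝕜)⁻¹ * (q - (q : 𝕜)⁻¹) ≠ 0 :=
    mul_ne_zero (by simp) (sub_inv_ne_zero hq₁ hq₂)
  have h (φ : SLq2 q →ₗ[𝕜] 𝕜) := hχ.sum_apply_mul_comm (isMultiplicativeMatrix_T q) φ
  have h₁ := h (ell hs 0 1) 0 0 1 0
  have h₂ := h (ell hs 0 1) 1 0 0 0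
  have h₃ := h (ell hs 0 1) 1 0 1 1
  have h₄ := h ((curry (rForm hs)).flip (T q 1 0)) 0 0 0 1
  simp only [Matrix.of_apply, ell_zero_one_T_mul_T, LinearMap.flip_apply, curry_apply,
    rForm_T_mul_T_tmul_T_one_zero, Fin.sum_univ_two, Fin.isValue, zero_ne_one, one_ne_zero,
    true_and, false_and, and_true, and_false, if_true, if_false] at h₁ h₂ h₃ h₄
  refine ⟨?_, ?_, ?_, ?_⟩ <;> refine mul_left_cancel₀ hc ?_
  · linear_combination h₁
  · linear_combination h₂
  · linear_combination h₃
  · linear_combination h₄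

theorem apply_T_tmul_T_eq_add (hχ : IsInfinitesimalRForm (R hs) χ) (hq₁ : q ≠ 1) (hq₂ : q ≠ -1)
    (i j k l : Fin 2) :
    χ (T q i j ⊗ₜ T q k l) = (if i = j ∧ k = l then χ (T q 0 0 ⊗ₜ T q 0 0) else 0) +
      (χ (T q 0 0 ⊗ₜ T q 1 1) - χ (T q 0 0 ⊗ₜ T q 0 0)) * (qvec q i k * qvec q j l) := by
  by_cases hw : (i : ℕ) + k = j + l
  · obtain ⟨h₁, h₂, h₃, h₄⟩ := apply_T_tmul_T_relations hχ hq₁ hq₂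
    set x := χ (T q 0 0 ⊗ₜ T q 0 0)
    set y := χ (T q 0 0 ⊗ₜ T q 1 1) - x with hy
    have had : χ (T q 0 0 ⊗ₜ T q 1 1) = x + y := by rw [hy]; ring
    have hbc : χ (T q 0 1 ⊗ₜ T q 1 0) = -(y * (q : 𝕜)⁻¹) := by
      field_simp
      linear_combination h₁ + hy
    have hcb : χ (T q 1 0 ⊗ₜ T q 0 1) = -(y * (q : 𝕜)⁻¹) := by
      field_simp
      linear_combination hy - h₄
    have hda : χ (T q 1 1 ⊗ₜ T q 0 0) = x + y * ((q : 𝕜)⁻¹ * (q : 𝕜)⁻¹) := by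
      rw [hcb] at h₂
      field_simp at h₂ ⊢
      linear_combination h₂
    have hdd : χ (T q 1 1 ⊗ₜ T q 1 1) = x := h₃.trans h₄.symm
    fin_cases i <;> fin_cases j <;> fin_cases k <;> fin_cases l <;>
      simp [qvec, had, hbc, hcb, hda, hdd, x] at hw ⊢
  · rw [apply_T_tmul_T_eq_zero_of_ne hχ hq₁ hq₂ hw]
    fin_cases i <;> fin_cases j <;> fin_cases k <;> fin_cases l <;> simp [qvec] at hw ⊢

theorem apply_T_tmul_T_eq_zero (hχ : IsInfinitesimalRForm (R hs) χ) (h2 : (2 : 𝕜) ≠ 0)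
    (hq₁ : q ≠ 1) (hq₂ : q ≠ -1) (i j k l : Fin 2) : χ (T q i j ⊗ₜ T q k l) = 0 := by
  have hform := apply_T_tmul_T_eq_add hχ hq₁ hq₂
  have had : χ (T q 0 0 ⊗ₜ T q 1 1) = -χ (T q 0 0 ⊗ₜ T q 0 0) :=
    eq_neg_of_add_eq_zero_right (apply_T_tmul_T_trace hχ 0)
  have hda : χ (T q 1 1 ⊗ₜ T q 0 0) = χ (T q 0 0 ⊗ₜ T q 0 0) +
      (-χ (T q 0 0 ⊗ₜ T q 0 0) - χ (T q 0 0 ⊗ₜ T q 0 0)) * ((q : 𝕜)⁻¹ * (q : 𝕜)⁻¹) := by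
    simpa [had, qvec] using hform 1 1 0 0
  have hdd : χ (T q 1 1 ⊗ₜ T q 1 1) = χ (T q 0 0 ⊗ₜ T q 0 0) := by simp [hform 1 1 1 1, qvec]
  have htrace := apply_T_tmul_T_trace hχ 1
  rw [hda, hdd] at htrace
  have hq : 2 * ((q : 𝕜) - (q : 𝕜)⁻¹) ≠ 0 := mul_ne_zero h2 (sub_inv_ne_zero hq₁ hq₂)
  have haa : χ (T q 0 0 ⊗ₜ T q 0 0) = 0 := by
    refine (mul_eq_zero.1 ?_).resolve_left hq
    field_simp at htrace ⊢
    linear_combination htrace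
  simp [hform i j k l, had, haa]

end

end SLq2

theorem mainTheorem12_general {𝕜 : Type*} [Field 𝕜] (h2 : (2 : 𝕜) ≠ 0) (q : 𝕜ˣ) (hq₁ : q ≠ 1)
    (hq₂ : q ≠ -1) (s : 𝕜ˣ) (hs : s ^ 2 = q) (χ : SLq2 q ⊗[𝕜] SLq2 q →ₗ[𝕜] 𝕜) :
    IsInfinitesimalRForm (SLq2.R hs) χ ↔ χ = 0 := by
  constructor
  · intro hχ
    exact hχ.eq_zero_of_adjoin_eq_top (SLq2.isMultiplicativeMatrix_T q) (SLq2.adjoin_range_T q)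
      (SLq2.apply_T_tmul_T_eq_zero hχ h2 hq₁ hq₂)
  · rintro rfl
    exact isInfinitesimalRForm_zero _

theorem mainTheorem12 (q : ℂˣ) (hq₁ : q ≠ 1) (hq₂ : q ≠ -1) (s : ℂˣ) (hs : s ^ 2 = q)
    (χ : SLq2 q ⊗[ℂ] SLq2 q →ₗ[ℂ] ℂ) :
    IsInfinitesimalRForm (SLq2.R hs) χ ↔ χ = 0 := by
  exact mainTheorem12_general two_ne_zero q hq₁ hq₂ s hs χ
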